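/- Let $p$ be a prime, $h\ge 1$, $q=p^h$, and let $0\le k\le n$ be integers. Let $\theta_k=(q^{k+1}-1)/(q-1)$ be the number of points of a $k$-dimensional projective space over $\mathbb F_q$. A $k$-space of $PG(n,q)$ is a subspace of projective dimension $k$. Let $C_k(n,q)$ be the $p$-ary linear code of points and $k$-spaces of $PG(n,q)$, that is, the $\mathbb F_p$-span, in the space of $\mathbb F_p$-valued functions on the points of $PG(n,q)$, of the incidence vectors of the $k$-spaces. The weight of a vector is the number of its nonzero positions. A $k$-blocking set of $PG(n,q)$ is a set of points that meets every $(n-k)$-dimensional subspace. It is called linear if there is an $\mathbb F_p$-subspace $U$ of $\mathbb F_q^{n+1}$ with $\dim_{\mathbb F_p}U=hk+1$ (an $hk$-dimensional projective subspace of $PG((n+1)h-1,p)$) such that it consists exactly of the points $\langle v\rangle_{\mathbb F_q}$ with $v\in U\setminus\{0\}$, and non-linear otherwise. (1) Assume $k\ge n/2$ and $p>7$. Every codeword of $C_k(n,q)$ whose weight lies in the open interval $\left(\theta_k,\ \frac{12\theta_k+6}{7}\right)$ is a nonzero scalar multiple of the incidence vector of a non-linear $k$-blocking set of $PG(n,q)$.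 (2) The minimum weight of $C_k(n,q)$ (the least weight of a nonzero codeword) is $\theta_k$, and the codewords of weight $\theta_k$ are exactly the nonzero scalar multiples of the incidence vectors of the $k$-spaces of $PG(n,q)$. -/

import Mathlib

/-- The point set of the projective space `PG(n,q)` over the field `F` with `q` elements. -/
abbrev PGPoint (n : ℕ) (F : Type*) [Field F] : Type _ :=
  Projectivization F (Fin (n + 1) → F)

/-- The subspaces of `PG(n,q)`. -/
abbrev PGSubspace (n : ℕ) (F : Type*) [Field F] : Type _ :=
  Projectivization.Subspace F (Fin (n + 1) → F)

/-- The (projective) dimension of the subspace `K` is `d`: its vector space dimension is `d + 1`. -/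
def IsSpaceOfDim {n : ℕ} {F : Type*} [Field F] (d : ℕ) (K : PGSubspace n F) : Prop :=
  Module.finrank F (Projectivization.Subspace.submodule K) = d + 1

/-- `θ_m = (q^(m+1) - 1) / (q - 1)`, the number of points of `PG(m,q)`. For `q ≥ 2` both the
subtractions and the division are exact. -/
def theta (q m : ℕ) : ℕ := (q ^ (m + 1) - 1) / (q - 1)

/-- The incidence vector over `𝔽_p` of a set of points. -/
noncomputable def incidenceVector (p : ℕ) {n : ℕ} {F : Type*} [Field F]
    (B : Set (PGPoint n F)) : PGPoint n F → ZMod p :=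
  B.indicator (fun _ => 1)

/-- The incidence matrix of `k`-spaces (rows) and points (columns) of `PG(n,q)`,
with entries in `𝔽_p`. -/
noncomputable def incidenceMatrix (p n k : ℕ) (F : Type*) [Field F] :
    Matrix {K : PGSubspace n F // IsSpaceOfDim k K} (PGPoint n F) (ZMod p) :=
  Matrix.of fun K => incidenceVector p (K.1 : Set (PGPoint n F))

/-- The `p`-ary linear code `C_k(n,q)` of points and `k`-spaces of `PG(n,q)`: the `𝔽_p`-span of the
rows of the incidence matrix. -/
noncomputable def pgCode (p n k : ℕ) (F : Type*) [Field F] :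
    Submodule (ZMod p) (PGPoint n F → ZMod p) :=
  Submodule.span (ZMod p) (Set.range (incidenceMatrix p n k F).row)

/-- The weight of a vector: the number of its nonzero positions. -/
noncomputable def weight {p n : ℕ} {F : Type*} [Field F] (c : PGPoint n F → ZMod p) : ℕ :=
  (Function.support c).ncard

/-- A `k`-blocking set of `PG(n,q)`: a set of points that meets every `(n-k)`-space. -/
def IsBlockingSet {n : ℕ} {F : Type*} [Field F] (k : ℕ) (B : Set (PGPoint n F)) : Prop :=
  ∀ S : PGSubspace n F, IsSpaceOfDim (n - k) S → ∃ P ∈ B, P ∈ S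

/-- For an `𝔽_p`-subspace `U` of `𝔽_q^(n+1)`, i.e. a subspace of `PG((n+1)h-1,p)`, the set `𝓑(U)` of
those points of `PG(n,q)` whose element of the Desarguesian spread meets `U`. The spread element
of a point `P` is `P` itself, a one-dimensional `𝔽_q`-space, seen as an `𝔽_p`-space; it meets `U`
projectively if and only if the two have a nonzero vector in common. -/
def spreadPoints {p n : ℕ} {F : Type*} [Field F] [Algebra (ZMod p) F]
    (U : Submodule (ZMod p) (Fin (n + 1) → F)) : Set (PGPoint n F) :=
  {P | ∃ v ∈ U, v ≠ 0 ∧ v ∈ P.submodule}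

/-- A linear `k`-blocking set of `PG(n,q)`, `q = p^h`: a set `𝓑(U)` for a subspace `U` of projective
dimension `hk`, so of vector space dimension `hk + 1`, of `PG((n+1)h-1,p)`. -/
def IsLinearBlockingSet (p h : ℕ) {n : ℕ} {F : Type*} [Field F] [Algebra (ZMod p) F] (k : ℕ)
    (B : Set (PGPoint n F)) : Prop :=
  ∃ U : Submodule (ZMod p) (Fin (n + 1) → F),
    Module.finrank (ZMod p) U = h * k + 1 ∧ B = spreadPoints U

/-! Field reduction: a codeword `c` of C_k(n,q) pulls back to a function `f` on V = F_q^(n+1), in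
the F_p-span of indicators of F_p-subspaces of dimension at least d = h(k+1). Each point contributes
q-1 vectors to the support, so everything becomes a statement about points of PG(V) over the prime
field, where θ_k corresponds to p^d - 1 nonzero vectors.

Such an `f` sums to zero over every subspace W of codimension less than d
(`apply_zero_add_ncard_mul_eq_zero`). Taking W maximal among subspaces that avoid the support, or
meet it only in one point, and projecting to V/W yields the minimum weight. It also shows that a
minimum-weight support, with 0 added, is closed under addition; it is stable under F_q-scalars,
hence is a k-space.

Part (1) holds because its interval contains no weights. For k ≥ 1, every codeword of projective
weight below about 2p^(d-1) over F_p is a multiple of a subspace indicator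
(`ncard_nzSupport_of_small`). The case d = 2 uses the polynomial method and a pairing of points
(`exists_plane_subset_nzSupport`). Larger d reduces to small d by restricting to a hyperplane
carrying at most its average share of the support (`exists_hyperplane_ge`). First the values are
shown to be constant, then the support to be additively closed. For p ≥ 11 this range covers the
interval. -/

open Module

/-! ### Codes spanned by subspaces over the prime field. -/

section SubspaceCode

variable {p : ℕ} [Fact p.Prime] {V : Type*} [AddCommGroup V] [Module (ZMod p) V]

variable (p V) in
/-- The span of the indicator functions (zero vector included) of the subspaces of `V` of vector
space dimension at least `d`. -/
def subspaceCode (d : ℕ) : Submodule (ZMod p) (V → ZMod p) :=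
  Submodule.span (ZMod p)
    {f | ∃ U : Submodule (ZMod p) V, d ≤ finrank (ZMod p) U ∧ f = (U : Set V).indicator 1}

/-- The nonzero vectors at which `f` does not vanish. -/
def nzSupport (f : V → ZMod p) : Set V := {v | v ≠ 0 ∧ f v ≠ 0}

omit [Module (ZMod p) V] in
theorem mem_nzSupport {f : V → ZMod p} {v : V} : v ∈ nzSupport f ↔ v ≠ 0 ∧ f v ≠ 0 := Iff.rfl

theorem indicator_mem_subspaceCode {d : ℕ} {U : Submodule (ZMod p) V}
    (hU : d ≤ finrank (ZMod p) U) : (U : Set V).indicator 1 ∈ subspaceCode p V d :=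
  Submodule.subset_span ⟨U, hU, rfl⟩

theorem subspaceCode_apply_smul {d : ℕ} {f : V → ZMod p} (hf : f ∈ subspaceCode p V d)
    {a : ZMod p} (ha : a ≠ 0) (v : V) : f (a • v) = f v := by
  induction hf using Submodule.span_induction with
  | mem x h =>
    obtain ⟨U, -, rfl⟩ := h
    by_cases h : v ∈ U <;> simp [Set.indicator, U.smul_mem_iff ha, h]
  | zero => rfl
  | add x y _ _ hx hy => simp [hx, hy]
  | smul b x _ hx => simp [hx]

theorem smul_mem_nzSupport {d : ℕ} {f : V → ZMod p} (hf : f ∈ subspaceCode p V d)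
    {a : ZMod p} (ha : a ≠ 0) {v : V} : a • v ∈ nzSupport f ↔ v ∈ nzSupport f := by
  simp [nzSupport, subspaceCode_apply_smul hf ha, ha]

variable [Finite V]

/-- Intersecting a generator with W costs at most codim W dimensions. This drives all inductions on
d. -/
theorem indicator_subspaceCode {d e : ℕ} {f : V → ZMod p} (hf : f ∈ subspaceCode p V d)
    (W : Submodule (ZMod p) V) (h : e + finrank (ZMod p) V ≤ d + finrank (ZMod p) W) :
    (W : Set V).indicator f ∈ subspaceCode p V e := by
  induction hf using Submodule.span_induction with
  | mem x hx =>
    obtain ⟨U, hU, rfl⟩ := hx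
    rw [Set.indicator_indicator, ← Submodule.coe_inf]
    apply indicator_mem_subspaceCode
    have h1 := Submodule.finrank_sup_add_finrank_inf_eq W U
    have h2 := Submodule.finrank_le (W ⊔ U)
    omega
  | zero => simp
  | add x y _ _ hx hy => rw [Set.indicator_add']; exact add_mem hx hy
  | smul b x _ hx =>
    have : (W : Set V).indicator (b • x) = b • (W : Set V).indicator x := by
      funext v
      by_cases h : v ∈ W <;> simp [Set.indicator, h]
    rw [this]
    exact Submodule.smul_mem _ _ hx

/-- A generator sums to the size of its subspace, a positive power of p. -/
theorem sum_subspaceCode_eq_zero [Fintype V] {f : V → ZMod p} (hf : f ∈ subspaceCode p V 1) :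
    ∑ v, f v = 0 := by
  classical
  induction hf using Submodule.span_induction with
  | mem x hx =>
    obtain ⟨U, hU, rfl⟩ := hx
    have : ∑ v, (U : Set V).indicator (1 : V → ZMod p) v = (Nat.card U : ZMod p) := by
      simp [Set.indicator_apply, Finset.sum_boole, Nat.card_eq_fintype_card, Fintype.card_subtype]
    rw [this, natCard_eq_pow_finrank (K := ZMod p), Nat.card_zmod]
    simp [show finrank (ZMod p) U ≠ 0 by omega]
  | zero => simp
  | add x y _ _ hx hy => simp [Finset.sum_add_distrib, hx, hy]
  | smul b x _ hx => simp [← Finset.mul_sum, hx]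

/-- Sum of a codeword over a subspace that meets all the generators of the code. -/
theorem finsum_mem_subspaceCode_eq_zero {d : ℕ} {f : V → ZMod p}
    (hf : f ∈ subspaceCode p V d) (W : Submodule (ZMod p) V)
    (h : finrank (ZMod p) V < d + finrank (ZMod p) W) : ∑ᶠ v ∈ (W : Set V), f v = 0 := by
  classical
  have := Fintype.ofFinite V
  have := sum_subspaceCode_eq_zero (indicator_subspaceCode (e := 1) hf W (by omega))
  rwa [finsum_mem_def, finsum_eq_sum_of_fintype]

/-- The vanishing of the sum over `W` when the codeword is constant on its support in `W`. -/
theorem apply_zero_add_ncard_mul_eq_zero {d : ℕ} {f : V → ZMod p}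
    (hf : f ∈ subspaceCode p V d) (W : Submodule (ZMod p) V)
    (h : finrank (ZMod p) V < d + finrank (ZMod p) W) {a : ZMod p}
    (ha : ∀ v ∈ nzSupport f, v ∈ W → f v = a) :
    f 0 + ((nzSupport f ∩ W).ncard : ZMod p) * a = 0 := by
  classical
  have := Fintype.ofFinite V
  rw [← finsum_mem_subspaceCode_eq_zero hf W h]
  have h0 : (0 : V) ∉ nzSupport f ∩ W := by simp [nzSupport]
  rw [← finsum_mem_inter_support, show (W : Set V) ∩ Function.support f =
    (insert 0 (nzSupport f ∩ W)) ∩ Function.support f by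
      ext v; by_cases hv : v = 0 <;> simp [hv, nzSupport, and_comm],
    finsum_mem_inter_support, finsum_mem_insert _ h0 (Set.toFinite _)]
  congr 1
  rw [finsum_mem_congr rfl (g := fun _ => a) (fun v hv => ha v hv.1 hv.2),
    finsum_mem_eq_toFinset_sum, Finset.sum_const, Set.ncard_eq_toFinset_card', nsmul_eq_mul]

theorem apply_zero_of_nzSupport_eq_empty {d : ℕ} (hd : 1 ≤ d) {f : V → ZMod p}
    (hf : f ∈ subspaceCode p V d) (h : nzSupport f = ∅) : f = 0 := by
  have h0 := apply_zero_add_ncard_mul_eq_zero hf ⊤ (by simp; omega) (a := 0)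
    (by simp [h])
  simp only [mul_zero, add_zero] at h0
  funext v
  by_contra hv
  have : v ∈ nzSupport f := ⟨fun h => hv (by rw [h, h0]; rfl), hv⟩
  simp [h] at this

/-- If every subspace properly containing `W` by one dimension meets `S` outside `W`, then `S`
has at least as many vectors outside `W` as there are nonzero vectors in `V ⧸ W`, and more if
two of them are congruent modulo `W`. -/
theorem card_quotient_le_ncard_diff {d : ℕ} {f : V → ZMod p} (hf : f ∈ subspaceCode p V d)
    (W : Submodule (ZMod p) V)
    (hW : ∀ x ∉ W, ∃ s ∈ nzSupport f, s ∉ W ∧ s ∈ W ⊔ Submodule.span (ZMod p) {x}) :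
    p ^ (finrank (ZMod p) V - finrank (ZMod p) W) ≤ (nzSupport f \ W).ncard + 1 ∧
    (∀ u ∈ nzSupport f, ∀ v ∈ nzSupport f, u ∉ W → u ≠ v → u - v ∈ W →
      p ^ (finrank (ZMod p) V - finrank (ZMod p) W) ≤ (nzSupport f \ W).ncard) := by
  classical
  have hfin : Finite (V ⧸ W) := Finite.of_surjective _ W.mkQ_surjective
  have hcard : Nat.card (V ⧸ W) = p ^ (finrank (ZMod p) V - finrank (ZMod p) W) := by
    rw [natCard_eq_pow_finrank (K := ZMod p), Nat.card_zmod]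
    congr 1
    have := W.finrank_quotient_add_finrank
    omega
  -- The support is closed under scaling, so a support vector in W + ⟨x⟩ outside W can be rescaled
  -- into the class of x itself.
  have himg : W.mkQ '' (nzSupport f \ W) = {0}ᶜ := by
    ext y
    obtain ⟨x, rfl⟩ := W.mkQ_surjective y
    simp only [Set.mem_image, Set.mem_compl_iff, Set.mem_singleton_iff]
    constructor
    · rintro ⟨s, hs, hsx⟩ h0
      rw [← hsx] at h0
      exact hs.2 (by simpa using h0)
    · intro hx
      have hxW : x ∉ W := by simpa using hx
      obtain ⟨s, hs, hsW, hsx⟩ := hW x hxW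
      obtain ⟨w, hw, z, hz, hwz⟩ := Submodule.mem_sup.1 hsx
      obtain ⟨a, rfl⟩ := Submodule.mem_span_singleton.1 hz
      have ha : a ≠ 0 := by
        rintro rfl
        apply hsW
        rw [← hwz]; simpa using hw
      refine ⟨a⁻¹ • s, ⟨(smul_mem_nzSupport hf (inv_ne_zero ha)).2 hs, ?_⟩, ?_⟩
      · rw [SetLike.mem_coe, W.smul_mem_iff (inv_ne_zero ha)]; exact hsW
      · rw [← hwz, smul_add, inv_smul_smul₀ ha, map_add]
        have : W.mkQ (a⁻¹ • w) = 0 :=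
          (Submodule.Quotient.mk_eq_zero W).2 (W.smul_mem a⁻¹ hw)
        rw [this, zero_add]
  have hc : ({0}ᶜ : Set (V ⧸ W)).ncard + 1 =
      p ^ (finrank (ZMod p) V - finrank (ZMod p) W) := by
    rw [← hcard, Set.ncard_compl, Set.ncard_singleton]
    have : 0 < Nat.card (V ⧸ W) := Nat.card_pos
    omega
  rw [← hc, ← himg]
  refine ⟨by have := Set.ncard_image_le (f := W.mkQ) (Set.toFinite (nzSupport f \ W)); omega, ?_⟩
  intro u hu v hv huW huv huvW
  have hvW : v ∉ W := fun h => huW (by simpa using add_mem huvW h)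
  -- Dropping u does not change the image, since v represents the same class; this gains the extra
  -- unit.
  have : (W.mkQ '' (nzSupport f \ W)) = W.mkQ '' ((nzSupport f \ W) \ {u}) := by
    apply subset_antisymm _ (Set.image_mono Set.sdiff_subset)
    rintro _ ⟨s, hs, rfl⟩
    by_cases hsu : s = u
    · exact ⟨v, ⟨⟨hv, hvW⟩, Ne.symm huv⟩, by
        rw [hsu]; exact ((Submodule.Quotient.eq W).2 huvW).symm⟩
    · exact ⟨s, ⟨hs, hsu⟩, rfl⟩
  rw [this]
  have h1 := Set.ncard_image_le (f := W.mkQ) (Set.toFinite ((nzSupport f \ W) \ {u}))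
  have h2 := Set.ncard_sdiff_singleton_add_one (s := nzSupport f \ W) (a := u) ⟨hu, huW⟩
  omega

end SubspaceCode

/-! ### Minimum weight and minimum-weight codewords. -/

section MinimumWeight

variable {p : ℕ} [Fact p.Prime] {V : Type*} [AddCommGroup V] [Module (ZMod p) V] [Finite V]

theorem ncard_submodule (L : Submodule (ZMod p) V) :
    (L : Set V).ncard = p ^ finrank (ZMod p) L := by
  rw [← Nat.card_coe_set_eq]
  exact (natCard_eq_pow_finrank (K := ZMod p) (V := L)).trans (by rw [Nat.card_zmod])

theorem ncard_submodule_diff_zero (L : Submodule (ZMod p) V) :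
    ((L : Set V) \ {0}).ncard + 1 = p ^ finrank (ZMod p) L := by
  rw [Set.ncard_sdiff_singleton_add_one L.zero_mem, ncard_submodule]

omit [Finite V] in
theorem nzSupport_inter_span_singleton {d : ℕ} {f : V → ZMod p} (hf : f ∈ subspaceCode p V d)
    {v : V} (hv : v ∈ nzSupport f) :
    nzSupport f ∩ (Submodule.span (ZMod p) {v} : Set V) =
      (Submodule.span (ZMod p) {v} : Set V) \ {0} := by
  ext s
  simp only [Set.mem_inter_iff, SetLike.mem_coe, Set.mem_sdiff, Set.mem_singleton_iff]
  refine ⟨fun h => ⟨h.2, h.1.1⟩, fun h => ⟨?_, h.1⟩⟩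
  obtain ⟨a, rfl⟩ := Submodule.mem_span_singleton.1 h.1
  refine (smul_mem_nzSupport hf ?_).2 hv
  rintro rfl
  simp at h

/-- A codeword takes its value at `0` at each point of a small support. -/
theorem apply_eq_apply_zero_of_ncard_lt {d : ℕ} {f : V → ZMod p}
    (hf : f ∈ subspaceCode p V d) (h : (nzSupport f).ncard < p ^ d) {v : V}
    (hv : v ∈ nzSupport f) : f v = f 0 := by
  classical
  -- W is maximal among subspaces through v meeting the support only in ⟨v⟩. The sum over W then
  -- reads f 0 + (p-1) f v = 0.
  obtain ⟨W, -, hW⟩ := Set.Finite.exists_le_maximal (a := Submodule.span (ZMod p) {v})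
    (s := {W : Submodule (ZMod p) V | v ∈ W ∧
      ∀ s ∈ nzSupport f, s ∈ W → s ∈ Submodule.span (ZMod p) {v}}) (Set.toFinite _)
    ⟨Submodule.mem_span_singleton_self v, fun s _ h => h⟩
  obtain ⟨hvW, hWs⟩ := hW.prop
  obtain ⟨h1, -⟩ := card_quotient_le_ncard_diff hf W (by
    intro x hx
    by_contra! hcon
    have := hW.le_of_ge (y := W ⊔ Submodule.span (ZMod p) {x})
      ⟨Submodule.mem_sup_left hvW, fun s hs hsx => by
        by_contra hsv
        exact hcon s hs (fun h => hsv (hWs s hs h)) hsx⟩ le_sup_left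
    exact hx (this (Submodule.mem_sup_right (Submodule.mem_span_singleton_self x))))
  -- Since v lies in W, the inequality is strict; this absorbs the +1 in `h1` and forces codim W <
  -- d.
  have h2 : (nzSupport f \ W).ncard < (nzSupport f).ncard :=
    Set.ncard_lt_ncard ⟨Set.sdiff_subset, fun h => (h hv).2 hvW⟩
  have h3 : finrank (ZMod p) V - finrank (ZMod p) W < d := by
    by_contra! h3
    have := Nat.pow_le_pow_right (Fact.out : p.Prime).pos h3
    omega
  have hS : nzSupport f ∩ W = (Submodule.span (ZMod p) {v} : Set V) \ {0} := by
    rw [← nzSupport_inter_span_singleton hf hv]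
    ext s
    refine ⟨fun h => ⟨h.1, hWs s h.1 h.2⟩, fun h => ⟨h.1, ?_⟩⟩
    exact (Submodule.span_singleton_le_iff_mem v W).2 hvW h.2
  have h4 := apply_zero_add_ncard_mul_eq_zero hf W (by omega) (a := f v) (by
    intro s hs hsW
    obtain ⟨a, rfl⟩ := Submodule.mem_span_singleton.1 (hWs s hs hsW)
    refine subspaceCode_apply_smul hf ?_ v
    rintro rfl
    exact hs.1 (by simp))
  have h5 := ncard_submodule_diff_zero (Submodule.span (ZMod p) {v})
  rw [finrank_span_singleton hv.1, pow_one, ← hS] at h5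
  have h6 : (((nzSupport f ∩ W).ncard + 1 : ℕ) : ZMod p) = 0 := by rw [h5]; simp
  push_cast at h6
  linear_combination -h4 + f v * h6

/-- Lower bounds on the support of a codeword not vanishing at `0`, from a subspace `X` that
misses the support. -/
theorem pow_le_ncard_nzSupport_of_disjoint {d : ℕ} {f : V → ZMod p}
    (hf : f ∈ subspaceCode p V d) (h0 : f 0 ≠ 0) (X : Submodule (ZMod p) V)
    (hX : ∀ x ∈ X, x ∉ nzSupport f) :
    p ^ d ≤ (nzSupport f).ncard + 1 ∧
    (∀ u ∈ nzSupport f, ∀ v ∈ nzSupport f, u ≠ v → u - v ∈ X →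
      p ^ d ≤ (nzSupport f).ncard) := by
  obtain ⟨W, hXW, hW⟩ := Set.Finite.exists_le_maximal (a := X)
    (s := {W : Submodule (ZMod p) V | ∀ x ∈ W, x ∉ nzSupport f}) (Set.toFinite _) hX
  have hWS := hW.prop
  obtain ⟨h1, h2⟩ := card_quotient_le_ncard_diff hf W (by
    intro x hx
    by_contra! hcon
    have := hW.le_of_ge (y := W ⊔ Submodule.span (ZMod p) {x})
      (fun s hsx hs => hcon s hs (fun h => hWS s h hs) hsx) le_sup_left
    exact hx (this (Submodule.mem_sup_right (Submodule.mem_span_singleton_self x))))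
  -- Otherwise the sum over W vanishes, but it equals f 0.
  have h3 : d ≤ finrank (ZMod p) V - finrank (ZMod p) W := by
    by_contra! h3
    have := apply_zero_add_ncard_mul_eq_zero hf W (by omega) (a := 0)
      (fun v hv hvW => absurd hv (hWS v hvW))
    simp [h0] at this
  have h4 := Nat.pow_le_pow_right (Fact.out : p.Prime).pos h3
  have h5 : (nzSupport f \ W).ncard ≤ (nzSupport f).ncard := Set.ncard_le_ncard Set.sdiff_subset
  refine ⟨by omega, fun u hu v hv huv huX => ?_⟩
  have := h2 u hu v hv (fun h => hWS u h hu) huv (hXW huX)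
  omega

/-- The minimum weight of the code spanned by the subspaces of dimension `d`. -/
theorem pow_le_ncard_nzSupport {d : ℕ} {f : V → ZMod p} (hf : f ∈ subspaceCode p V d)
    (hne : (nzSupport f).Nonempty) : p ^ d ≤ (nzSupport f).ncard + 1 := by
  by_cases h : (nzSupport f).ncard < p ^ d
  · obtain ⟨v, hv⟩ := hne
    have h0 : f 0 ≠ 0 := by rw [← apply_eq_apply_zero_of_ncard_lt hf h hv]; exact hv.2
    exact (pow_le_ncard_nzSupport_of_disjoint hf h0 ⊥ (by simp [nzSupport])).1
  · omega

/-- The codewords of minimum weight are supported by a subspace. -/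
theorem add_mem_nzSupport_of_ncard_lt {d : ℕ} {f : V → ZMod p} (hf : f ∈ subspaceCode p V d)
    (h : (nzSupport f).ncard < p ^ d) {u v : V} (hu : u ∈ nzSupport f) (hv : v ∈ nzSupport f)
    (huv : u + v ≠ 0) : u + v ∈ nzSupport f := by
  by_contra hcon
  have h0 : f 0 ≠ 0 := by rw [← apply_eq_apply_zero_of_ncard_lt hf h hv]; exact hv.2
  have hneg : -v ∈ nzSupport f := by
    have := (smul_mem_nzSupport hf (a := -1) (neg_ne_zero.2 one_ne_zero)).2 hv
    rwa [neg_one_smul] at this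
  -- The line ⟨u + v⟩ misses the support while u and -v are congruent modulo it, so the support has
  -- at least p^d vectors.
  have := (pow_le_ncard_nzSupport_of_disjoint hf h0 (Submodule.span (ZMod p) {u + v}) (by
    intro x hx hxS
    obtain ⟨a, rfl⟩ := Submodule.mem_span_singleton.1 hx
    refine hcon ((smul_mem_nzSupport hf (a := a) ?_).1 hxS)
    rintro rfl
    exact hxS.1 (by simp))).2 u hu (-v) hneg (fun h => huv (by rw [h]; simp))
    (by rw [sub_neg_eq_add]; exact Submodule.mem_span_singleton_self _)
  omega

end MinimumWeight

/-! ### Counting vectors versus points. -/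

section PointCount

open Projectivization

/-- The nonzero vectors that represent a point of `B`. -/
theorem ncard_setOf_mk_mem {K V : Type*} [Field K] [Finite K] [AddCommGroup V] [Module K V]
    (B : Set (Projectivization K V)) :
    {v : V | ∃ hv : v ≠ 0, mk K v hv ∈ B}.ncard = (Nat.card K - 1) * B.ncard := by
  have himg : {v : V | ∃ hv : v ≠ 0, mk K v hv ∈ B} =
      (fun x : Kˣ × Projectivization K V => x.1 • x.2.rep) '' (Set.univ ×ˢ B) := by
    ext v
    constructor
    · rintro ⟨hv, hB⟩
      obtain ⟨a, ha⟩ := exists_smul_eq_mk_rep K v hv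
      exact ⟨(a⁻¹, mk K v hv), ⟨trivial, hB⟩, by simp [← ha]⟩
    · rintro ⟨⟨a, P⟩, ⟨-, hP⟩, rfl⟩
      have h0 : a • P.rep ≠ 0 := (smul_ne_zero_iff_ne a).2 P.rep_nonzero
      refine ⟨h0, ?_⟩
      have : mk K (a • P.rep) h0 = P := by
        conv_rhs => rw [← mk_rep P]
        exact (mk_eq_mk_iff K _ _ _ _).2 ⟨a, rfl⟩
      rwa [this]
  have hinj : Function.Injective (fun x : Kˣ × Projectivization K V => x.1 • x.2.rep) := by
    rintro ⟨a, P⟩ ⟨b, Q⟩ h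
    simp only at h
    have hPQ : P = Q := by
      rw [← mk_rep P, ← mk_rep Q]
      refine (mk_eq_mk_iff K _ _ _ _).2 ⟨a⁻¹ * b, ?_⟩
      rw [mul_smul, ← h, inv_smul_smul]
    subst hPQ
    have : a = b := by
      ext
      exact smul_left_injective K P.rep_nonzero h
    rw [this]
  rw [himg, Set.ncard_image_of_injective _ hinj, Set.ncard_prod, Set.ncard_univ, Nat.card_units]

end PointCount

/-! ### A combinatorial pairing lemma. -/

section Pairing

/-- A family of at most `2 * r` elements in which no colour occurs more than `r` times can be
ordered so that elements at distance `r` have different colours. -/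
theorem exists_perm_ne_of_card_le {N r : ℕ} {β : Type*} [LinearOrder β] (g : Fin N → β)
    (h : ∀ b, (Finset.univ.filter fun i => g i = b).card ≤ r) :
    ∃ σ : Equiv.Perm (Fin N), ∀ i j : Fin N, (j : ℕ) = i + r → g (σ i) ≠ g (σ j) := by
  refine ⟨Tuple.sort g, fun i j hij heq => ?_⟩
  have hmono := Tuple.monotone_sort g
  -- In sorted order, equal colours at i and j = i + r force r + 1 elements of that colour.
  have hsub : (Finset.Icc i j).map (Tuple.sort g).toEmbedding ⊆
      Finset.univ.filter fun k => g k = g (Tuple.sort g j) := by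
    intro k hk
    obtain ⟨l, hl, rfl⟩ := Finset.mem_map.1 hk
    obtain ⟨hil, hlj⟩ := Finset.mem_Icc.1 hl
    simp only [Finset.mem_filter, Finset.mem_univ, true_and]
    exact le_antisymm (hmono hlj) (heq ▸ hmono hil)
  have := (Finset.card_le_card hsub).trans (h _)
  rw [Finset.card_map, Fin.card_Icc] at this
  omega

end Pairing

/-! ### The polynomial method for d = 2. -/

section PlaneCode

variable {p : ℕ} [Fact p.Prime] {V : Type*} [AddCommGroup V] [Module (ZMod p) V] [Finite V]

omit [Finite V] in
theorem finrank_span_pair_eq_two {u v : V} (hu : u ≠ 0)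
    (hv : v ∉ Submodule.span (ZMod p) {u}) :
    finrank (ZMod p) (Submodule.span (ZMod p) {u, v}) = 2 := by
  have hli : LinearIndependent (ZMod p) ![u, v] :=
    (LinearIndependent.pair_iff' hu).2 fun a ha => hv (Submodule.mem_span_singleton.2 ⟨a, ha⟩)
  have := finrank_span_eq_card hli
  rwa [Matrix.range_cons_cons_empty, Fintype.card_fin] at this

/-- A polynomial function of degree less than `(p-1) dim U`, given as a product of linear forms,
sums to zero over `U`. -/
theorem sum_prod_dual_eq_zero {U : Type*} [AddCommGroup U] [Module (ZMod p) U] [Fintype U]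
    {r : ℕ} (ℓ : Fin r → Dual (ZMod p) U) (h : r < (p - 1) * finrank (ZMod p) U) :
    ∑ v, ∏ i, ℓ i v = 0 := by
  classical
  let b := finBasis (ZMod p) U
  let P : MvPolynomial (Fin (finrank (ZMod p) U)) (ZMod p) :=
    ∏ i, ∑ j, MvPolynomial.C (ℓ i (b j)) * MvPolynomial.X j
  have hdeg : P.totalDegree ≤ r := by
    refine (MvPolynomial.totalDegree_finsetProd _ _).trans ?_
    refine (Finset.sum_le_card_nsmul _ _ 1 fun i _ => ?_).trans (by simp)
    refine MvPolynomial.totalDegree_finsetSum_le fun j _ => ?_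
    refine (MvPolynomial.totalDegree_mul _ _).trans ?_
    simp
  have h0 := MvPolynomial.sum_eval_eq_zero P (by rw [ZMod.card, Fintype.card_fin]; omega)
  rw [← h0]
  refine Fintype.sum_equiv b.equivFun.toEquiv _ _ fun v => ?_
  simp only [P, map_prod, map_sum, map_mul, MvPolynomial.eval_C, MvPolynomial.eval_X]
  refine Finset.prod_congr rfl fun i _ => ?_
  conv_lhs => rw [← b.sum_equivFun v, map_sum]
  exact Finset.sum_congr rfl fun j _ => by rw [map_smul, smul_eq_mul, mul_comm]; rfl

-- The product has degree p-1 < 2(p-1), so it is orthogonal to every generator.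
omit [Finite V] in
theorem sum_mul_prod_dual_eq_zero [Fintype V] {f : V → ZMod p}
    (hf : f ∈ subspaceCode p V 2) (ℓ : Fin (p - 1) → Dual (ZMod p) V) :
    ∑ v, f v * ∏ i, ℓ i v = 0 := by
  classical
  induction hf using Submodule.span_induction with
  | mem x hx =>
    obtain ⟨U, hU, rfl⟩ := hx
    have := sum_prod_dual_eq_zero (U := U) (fun i => (ℓ i).domRestrict U) (by
      have := (Fact.out : p.Prime).two_le
      nlinarith [Nat.sub_add_cancel (show 1 ≤ p by omega), Nat.mul_le_mul_left (p - 1) hU])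
    rw [← this]
    simp only [Set.indicator_apply, Pi.one_apply, ite_mul, one_mul, zero_mul, SetLike.mem_coe]
    rw [← Finset.sum_filter]
    exact Finset.sum_subtype _ (by simp) (fun v => ∏ i, ℓ i v)
  | zero => simp
  | add x y _ _ hx hy => simp [add_mul, Finset.sum_add_distrib, hx, hy]
  | smul b x _ hx => simp [mul_assoc, ← Finset.mul_sum, hx]

/-- The points of the support of a codeword other than `u` cannot be covered by `p-1`
hyperplanes not through `u`. -/
theorem exists_mem_nzSupport_not_covered {f : V → ZMod p} (hf : f ∈ subspaceCode p V 2)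
    {u : V} (hu : u ∈ nzSupport f) (W : Fin (p - 1) → Submodule (ZMod p) V)
    (hW : ∀ i, u ∉ W i) :
    ∃ v ∈ nzSupport f, v ∉ Submodule.span (ZMod p) {u} ∧ ∀ i, v ∉ W i := by
  classical
  have := Fintype.ofFinite V
  by_contra! hcon
  choose ℓ hℓu hℓW using fun i => Submodule.exists_le_ker_of_notMem (hW i)
  have hsum := sum_mul_prod_dual_eq_zero hf ℓ
  have hp := (Fact.out : p.Prime).two_le
  have hp1 : 0 < p - 1 := by omega
  -- Forms vanishing on the `W i` but not at u kill every support vector outside ⟨u⟩.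
  have hL : ∑ v ∈ (Finset.univ.filter fun v => v ∈ Submodule.span (ZMod p) {u} ∧ v ≠ 0),
      f v * ∏ i, ℓ i v = 0 := by
    rw [← hsum]
    refine Finset.sum_subset (Finset.subset_univ _) fun v _ hv => ?_
    simp only [Finset.mem_filter, Finset.mem_univ, true_and, not_and_or, not_not] at hv
    by_cases hv0 : v = 0
    · rw [hv0, Finset.prod_eq_zero (i := ⟨0, hp1⟩) (Finset.mem_univ _) (map_zero _), mul_zero]
    by_cases hfv : f v = 0
    · rw [hfv, zero_mul]
    obtain ⟨i, hi⟩ := hcon v ⟨hv0, hfv⟩ (by tauto)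
    rw [Finset.prod_eq_zero (i := i) (Finset.mem_univ _)
      (LinearMap.mem_ker.1 (hℓW i hi)), mul_zero]
  -- The p-1 nonzero multiples a • u contribute equally, because a^(p-1) = 1; their sum is -f u
  -- times a nonzero product.
  rw [Finset.sum_congr rfl (g := fun _ => f u * ∏ i, ℓ i u) (fun v hv => by
    obtain ⟨hvu, hv0⟩ := (Finset.mem_filter.1 hv).2
    obtain ⟨a, rfl⟩ := Submodule.mem_span_singleton.1 hvu
    have ha : a ≠ 0 := by rintro rfl; simp at hv0
    rw [subspaceCode_apply_smul hf ha]
    simp [Finset.prod_mul_distrib, ZMod.pow_card_sub_one_eq_one ha]), Finset.sum_const] at hL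
  have hcard := ncard_submodule_diff_zero (Submodule.span (ZMod p) {u})
  rw [finrank_span_singleton hu.1, pow_one] at hcard
  have hcard' : (Finset.univ.filter fun v => v ∈ Submodule.span (ZMod p) {u} ∧ v ≠ 0).card =
      p - 1 := by
    rw [← Set.ncard_coe_finset]
    have : ((Finset.univ.filter fun v => v ∈ Submodule.span (ZMod p) {u} ∧ v ≠ 0 : Finset V) :
      Set V) = (Submodule.span (ZMod p) {u} : Set V) \ {0} := by ext; simp
    rw [this]
    omega
  rw [hcard', nsmul_eq_mul, Nat.cast_sub (by omega)] at hL
  simp only [CharP.cast_eq_zero, Nat.cast_one, zero_sub, neg_mul, one_mul, neg_eq_zero,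
    mul_eq_zero, hu.2, Finset.prod_eq_zero_iff, Finset.mem_univ, true_and, false_or] at hL
  obtain ⟨i, hi⟩ := hL
  exact hℓu i hi

end PlaneCode

/-! ### Classification of small-weight codewords for d = 2. -/

section PlaneCode

variable {p : ℕ} [Fact p.Prime] {V : Type*} [AddCommGroup V] [Module (ZMod p) V] [Finite V]

omit [Finite V] in
/-- If `u` lies in the span of `a` and `b`, neither of which is a nonzero multiple of `u`, then the
three vectors lie in a common plane, spanned by `u` and either of the others. -/
theorem span_pair_eq_of_mem_span_pair {u a b : V} (hu : u ≠ 0)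
    (ha : a ∉ Submodule.span (ZMod p) {u}) (hb : b = 0 ∨ b ∉ Submodule.span (ZMod p) {u})
    (h : u ∈ Submodule.span (ZMod p) {a, b}) :
    b ≠ 0 ∧ Submodule.span (ZMod p) {u, a} = Submodule.span (ZMod p) {u, b} := by
  obtain ⟨x, y, hxy⟩ := Submodule.mem_span_pair.1 h
  have key : ∀ (c e : V) (s t : ZMod p), s • c + t • e = u → s ≠ 0 →
      c ∈ Submodule.span (ZMod p) {u, e} := fun c e s t hst hs =>
    Submodule.mem_span_pair.2 ⟨s⁻¹, -(s⁻¹ * t), by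
      rw [← hst, smul_add, inv_smul_smul₀ hs, smul_smul]; module⟩
  have key' : ∀ (c : V) (s : ZMod p), s • c = u → c ∈ Submodule.span (ZMod p) {u} := by
    rintro c s rfl
    have hs : s ≠ 0 := by rintro rfl; simp at hu
    exact Submodule.mem_span_singleton.2 ⟨s⁻¹, inv_smul_smul₀ hs c⟩
  have hby : y • b ≠ 0 := fun h0 => ha (key' a x (by rw [← hxy, h0, add_zero]))
  have hb0 : b ≠ 0 := by rintro rfl; simp at hby
  have hy0 : y ≠ 0 := by rintro rfl; simp at hby
  have hx0 : x ≠ 0 := by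
    rintro rfl
    exact hb.resolve_left hb0 (key' b y (by simpa using hxy))
  refine ⟨hb0, le_antisymm ?_ ?_⟩ <;> rw [Submodule.span_le, Set.insert_subset_iff,
    Set.singleton_subset_iff]
  · exact ⟨Submodule.subset_span (by simp), key a b x y hxy hx0⟩
  · exact ⟨Submodule.subset_span (by simp), key b a y x (by rw [add_comm, hxy]) hy0⟩

-- If no projective line through u lay in the support, the at most 2(p-1) other points could be
-- paired so that no pair is collinear with u. The spans of the pairs would be p-1 subspaces
-- avoiding u and covering all other points, which `exists_mem_nzSupport_not_covered` forbids.
open Projectivization in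
theorem exists_plane_subset_nzSupport {f : V → ZMod p} (hf : f ∈ subspaceCode p V 2)
    (hcard : (nzSupport f).ncard < 2 * p * (p - 1)) {u : V} (hu : u ∈ nzSupport f) :
    ∃ L : Submodule (ZMod p) V, finrank (ZMod p) L = 2 ∧ u ∈ L ∧
      ∀ v ∈ L, v ≠ 0 → v ∈ nzSupport f := by
  classical
  by_contra! hcon
  have hp := (Fact.out : p.Prime).two_le
  obtain ⟨r, rfl⟩ : ∃ r, p = r + 1 := ⟨p - 1, by omega⟩
  have hspan := nzSupport_inter_span_singleton hf hu
  have hspanc := ncard_submodule_diff_zero (Submodule.span (ZMod (r + 1)) {u})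
  rw [finrank_span_singleton hu.1, pow_one] at hspanc
  -- the points of the support other than the one of `u`
  let A : Set (Projectivization (ZMod (r + 1)) V) :=
    {P | P.rep ∈ nzSupport f ∧ P.rep ∉ Submodule.span (ZMod (r + 1)) {u}}
  have hA : ∀ (v : V) (hv : v ≠ 0), mk (ZMod (r + 1)) v hv ∈ A ↔
      v ∈ nzSupport f ∧ v ∉ Submodule.span (ZMod (r + 1)) {u} := by
    intro v hv
    obtain ⟨a, ha⟩ := exists_smul_eq_mk_rep (ZMod (r + 1)) v hv
    simp only [A, Set.mem_ofPred_eq, ← ha, Units.smul_def, smul_mem_nzSupport hf a.ne_zero,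
      Submodule.smul_mem_iff _ a.ne_zero]
  have hcount := fun B => ncard_setOf_mk_mem (K := ZMod (r + 1)) (V := V) B
  simp only [Nat.card_zmod, Nat.add_sub_cancel] at hcount hcard
  have hAle : A.ncard ≤ 2 * r := by
    have h1 : {v : V | ∃ hv : v ≠ 0, mk (ZMod (r + 1)) v hv ∈ A} =
        nzSupport f \ Submodule.span (ZMod (r + 1)) {u} := by
      ext v
      constructor
      · rintro ⟨hv, h⟩; exact (hA v hv).1 h
      · rintro h; exact ⟨h.1.1, (hA v h.1.1).2 h⟩
    have h2 := Set.ncard_inter_add_ncard_sdiff_eq_ncard (nzSupport f)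
      (Submodule.span (ZMod (r + 1)) {u} : Set V)
    rw [hspan, ← h1, hcount] at h2
    have h3 : r * (A.ncard + 1) < r * (2 * (r + 1)) := by nlinarith
    have := Nat.lt_of_mul_lt_mul_left h3
    omega
  -- the points on a line through the point of `u`
  let col : Projectivization (ZMod (r + 1)) V → Submodule (ZMod (r + 1)) V :=
    fun P => Submodule.span (ZMod (r + 1)) {u, P.rep}
  -- A projective line through u has p further points, and one of them is missing from the support,
  -- leaving at most r = p-1.
  have hcol : ∀ L, {P ∈ A | col P = L}.ncard ≤ r := by
    intro L
    by_contra! hlt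
    obtain ⟨P, hPA, rfl⟩ := Set.nonempty_of_ncard_ne_zero (s := {P ∈ A | col P = L}) (by omega)
    have hfr : finrank (ZMod (r + 1)) (col P) = 2 := finrank_span_pair_eq_two hu.1 hPA.2
    have huP : u ∈ col P := Submodule.subset_span (by simp)
    obtain ⟨w, hwL, hw0, hw⟩ := hcon (col P) hfr huP
    have h1 : {v : V | ∃ hv : v ≠ 0, mk (ZMod (r + 1)) v hv ∈ {Q ∈ A | col Q = col P}} ⊆
        ((col P : Set V) \ {0}) \
          (insert w ((Submodule.span (ZMod (r + 1)) {u} : Set V) \ {0})) := by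
      rintro v ⟨hv, hvA, hvc⟩
      obtain ⟨h2, h3⟩ := (hA v hv).1 hvA
      refine ⟨⟨?_, hv⟩, ?_⟩
      · rw [← hvc]
        obtain ⟨a, ha⟩ := exists_smul_eq_mk_rep (ZMod (r + 1)) v hv
        have h4 : (mk (ZMod (r + 1)) v hv).rep ∈ col (mk (ZMod (r + 1)) v hv) :=
          Submodule.subset_span (by simp)
        rw [← ha, Units.smul_def] at h4
        exact (Submodule.smul_mem_iff _ a.ne_zero).1 h4
      · rintro (rfl | h)
        · exact hw h2
        · exact h3 h.1
    have h2 := Set.ncard_le_ncard h1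
    have hsub : insert w ((Submodule.span (ZMod (r + 1)) {u} : Set V) \ {0}) ⊆
        (col P : Set V) \ {0} := by
      rw [Set.insert_subset_iff]
      refine ⟨⟨hwL, hw0⟩, Set.sdiff_subset_sdiff_left ?_⟩
      exact (Submodule.span_singleton_le_iff_mem _ _).2 huP
    have h3 := Set.ncard_sdiff_add_ncard_of_subset hsub
    have h4 := ncard_submodule_diff_zero (col P)
    have hwn : w ∉ (Submodule.span (ZMod (r + 1)) {u} : Set V) \ {0} := by
      rw [← hspan]; exact fun h => hw h.1
    rw [Set.ncard_insert_of_notMem hwn] at h3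
    rw [hfr] at h4
    rw [hcount] at h2
    have h5 : r * (r + 1) ≤ r * {Q ∈ A | col Q = col P}.ncard := Nat.mul_le_mul_left _ hlt
    nlinarith
  -- order the points of `A` so that points at distance `r` are not on a line with `u`
  let e : Fin A.ncard ≃ A := (Finite.equivFinOfCardEq (Nat.card_coe_set_eq A)).symm
  let c := Finite.equivFin (Submodule (ZMod (r + 1)) V)
  obtain ⟨σ, hσ⟩ := exists_perm_ne_of_card_le (r := r) (fun i => c (col (e i))) (by
    intro b
    refine le_trans ?_ (hcol (c.symm b))
    rw [← Set.ncard_coe_finset]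
    refine Set.ncard_le_ncard_of_injOn (fun i => (e i : Projectivization (ZMod (r + 1)) V)) ?_ ?_
    · intro i hi
      refine ⟨(e i).2, ?_⟩
      simp only [Finset.coe_filter, Finset.mem_univ, true_and, Set.mem_ofPred_eq] at hi
      rw [← hi, Equiv.symm_apply_apply]
    · exact fun i _ j _ hij => e.injective (Subtype.ext hij))
  -- The default 0 pads the list, so an unpaired point is covered by its own span.
  let a : ℕ → V := fun i => if h : i < A.ncard then (e (σ ⟨i, h⟩)).1.rep else 0
  have ha : ∀ i, a i = 0 ∨ a i ∉ Submodule.span (ZMod (r + 1)) {u} := by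
    intro i
    by_cases h : i < A.ncard
    · right
      simp only [a, h, dite_true]
      exact (e (σ ⟨i, h⟩)).2.2
    · left; simp [a, h]
  obtain ⟨v, hv, hvu, hvW⟩ := exists_mem_nzSupport_not_covered hf hu
    (fun i => Submodule.span (ZMod (r + 1)) {a i, a (i + r)}) (by
    intro i hi
    by_cases h0 : (i : ℕ) < A.ncard
    · have h1 := (e (σ ⟨i, h0⟩)).2.2
      obtain ⟨h2, h3⟩ := span_pair_eq_of_mem_span_pair hu.1
        (by simp only [a, h0, dite_true]; exact h1) (ha _) hi
      have h4 : (i : ℕ) + r < A.ncard := by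
        by_contra h4
        simp [a, h4] at h2
      refine hσ ⟨i, h0⟩ ⟨i + r, h4⟩ rfl ?_
      simp only [a, h0, h4, dite_true] at h3
      exact congrArg c h3
    · have h1 : ¬ (i : ℕ) + r < A.ncard := by omega
      simp [a, h0, h1, hu.1] at hi)
  obtain ⟨i, hi⟩ := e.surjective ⟨_, (hA v hv.1).2 ⟨hv, hvu⟩⟩
  obtain ⟨j, rfl⟩ := σ.surjective i
  have haj : a j = (mk (ZMod (r + 1)) v hv.1).rep := by
    simp only [a, j.2, dite_true]
    rw [hi]
  obtain ⟨t, ht⟩ := exists_smul_eq_mk_rep (ZMod (r + 1)) v hv.1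
  have hjr := j.2
  have hmem : ∀ W : Submodule (ZMod (r + 1)) V, a j ∈ W → v ∈ W := by
    intro W hW
    rw [haj, ← ht, Units.smul_def] at hW
    exact (Submodule.smul_mem_iff _ t.ne_zero).1 hW
  by_cases hj : (j : ℕ) < r
  · exact hvW ⟨j, by omega⟩ (hmem _ (Submodule.subset_span (by simp)))
  · refine hvW ⟨j - r, by omega⟩ (hmem _ (Submodule.subset_span ?_))
    simp [Nat.sub_add_cancel (show r ≤ j by omega)]

/-- The codewords of small weight of the code of points and lines. -/
theorem eq_smul_indicator_of_ncard_lt_two {f : V → ZMod p} (hf : f ∈ subspaceCode p V 2)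
    (hcard : (nzSupport f).ncard < 2 * p * (p - 1)) :
    ∃ U : Submodule (ZMod p) V, f = f 0 • (U : Set V).indicator 1 := by
  classical
  obtain hS | ⟨u, hu⟩ := (nzSupport f).eq_empty_or_nonempty
  · refine ⟨⊥, ?_⟩
    rw [apply_zero_of_nzSupport_eq_empty (by norm_num) hf hS]
    simp
  have hp := (Fact.out : p.Prime).two_le
  obtain ⟨L, hL2, huL, hL⟩ := exists_plane_subset_nzSupport hf hcard hu
  have hLc := ncard_submodule_diff_zero L
  -- A support vector off L would give a second plane M in the support; L ∪ M has at least 2p² - p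
  -- vectors, too many.
  have hSL : nzSupport f ⊆ (L : Set V) \ {0} := by
    intro v hv
    refine ⟨?_, hv.1⟩
    by_contra hvL
    obtain ⟨M, hM2, hvM, hM⟩ := exists_plane_subset_nzSupport hf hcard hv
    have h1 := Set.ncard_union_add_ncard_inter (L : Set V) (M : Set V)
    rw [← Submodule.coe_inf, ncard_submodule, ncard_submodule, ncard_submodule, hL2, hM2] at h1
    have h2 : finrank (ZMod p) (L ⊓ M : Submodule (ZMod p) V) < 2 := by
      rw [← hM2]
      refine Submodule.finrank_lt_finrank_of_lt (lt_of_le_of_ne inf_le_right fun h => hvL ?_)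
      rw [← h] at hvM
      exact hvM.1
    have h3 := Nat.pow_le_pow_right (Fact.out : p.Prime).pos (Nat.le_of_lt_succ h2)
    have h4 : (L ∪ M : Set V) ⊆ insert 0 (nzSupport f) := by
      intro x hx
      by_cases hx0 : x = 0
      · exact Or.inl hx0
      · exact Or.inr (hx.elim (fun h => hL x h hx0) (fun h => hM x h hx0))
    have h5 := (Set.ncard_le_ncard h4).trans (Set.ncard_insert_le _ _)
    obtain ⟨r, rfl⟩ : ∃ r, p = r + 1 := ⟨p - 1, by omega⟩
    simp only [Nat.add_sub_cancel] at hcard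
    nlinarith
  -- This difference vanishes off L and at u, so its support falls below the minimum weight.
  have hg : f - f u • (L : Set V).indicator 1 ∈ subspaceCode p V 2 :=
    sub_mem hf (Submodule.smul_mem _ _ (indicator_mem_subspaceCode hL2.ge))
  have hgS : nzSupport (f - f u • (L : Set V).indicator 1) ⊆ ((L : Set V) \ {0}) \ {u} := by
    intro v hv
    have hvL : v ∈ L := by
      by_contra hvL
      refine hv.2 ?_
      have : f v = 0 := by
        by_contra h
        exact hvL (hSL ⟨hv.1, h⟩).1
      simp [hvL, this]
    refine ⟨⟨hvL, hv.1⟩, ?_⟩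
    rintro rfl
    simpa [hvL] using hv.2
  have hg0 : f - f u • (L : Set V).indicator 1 = 0 := by
    refine apply_zero_of_nzSupport_eq_empty (by norm_num) hg ?_
    by_contra hne
    have h1 := pow_le_ncard_nzSupport hg (Set.nonempty_iff_ne_empty.2 hne)
    have h2 := Set.ncard_le_ncard hgS
    have h3 := Set.ncard_sdiff_singleton_add_one (s := (L : Set V) \ {0}) (a := u) ⟨huL, hu.1⟩
    rw [hL2] at hLc
    omega
  have hfu : f 0 = f u := by simpa [sub_eq_zero] using congrFun hg0 0
  exact ⟨L, by rw [hfu]; exact sub_eq_zero.1 hg0⟩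

end PlaneCode

/-! ### Hyperplanes with few support vectors. -/

section Averaging

variable {p : ℕ} [Fact p.Prime] {V : Type*} [AddCommGroup V] [Module (ZMod p) V]

theorem exists_dual_apply_eq_zero_card {M : Type*} [AddCommGroup M] [Module (ZMod p) M]
    (g : M →ₗ[ZMod p] ZMod p) (hg : g ≠ 0) :
    p * Nat.card (LinearMap.ker g) = Nat.card M := by
  rw [Submodule.card_eq_card_quotient_mul_card (LinearMap.ker g),
    Nat.card_congr (g.quotKerEquivOfSurjective (LinearMap.surjective hg)).toEquiv, Nat.card_zmod,
    mul_comm]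

variable [Finite V]

/-- Some subspace of codimension at most one that contains `L` contains at most its share of the
vectors of `T` outside `L`. -/
theorem exists_hyperplane_ge (T : Set V) (L : Submodule (ZMod p) V) :
    ∃ H : Submodule (ZMod p) V, L ≤ H ∧ finrank (ZMod p) V ≤ finrank (ZMod p) H + 1 ∧
      p * ((T ∩ H) \ L).ncard ≤ (T \ L).ncard := by
  classical
  have := Fintype.ofFinite V
  have hfin : Finite (Dual (ZMod p) V) := Finite.of_injective _ DFunLike.coe_injective
  have := Fintype.ofFinite L.dualAnnihilator
  -- Average over all functionals vanishing on L: exactly one in p kills a given vector outside L.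
  -- The count includes the zero functional, whence codimension at most one.
  suffices h : ∃ φ : L.dualAnnihilator,
      p * ((T ∩ LinearMap.ker φ.1) \ L).ncard ≤ (T \ L).ncard by
    obtain ⟨φ, hφ⟩ := h
    refine ⟨LinearMap.ker φ.1, fun x hx => (Submodule.mem_dualAnnihilator _).1 φ.2 x hx, ?_, hφ⟩
    have h1 := φ.1.finrank_range_add_finrank_ker
    have h2 := Submodule.finrank_le (LinearMap.range φ.1)
    rw [finrank_self] at h2
    omega
  by_contra! hcon
  have hcount : ∀ v ∈ (T \ L).toFinset,
      p * (Finset.univ.filter fun φ : L.dualAnnihilator => φ.1 v = 0).card =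
        Fintype.card L.dualAnnihilator := by
    intro v hv
    simp only [Set.mem_toFinset, Set.mem_sdiff, SetLike.mem_coe] at hv
    let g : L.dualAnnihilator →ₗ[ZMod p] ZMod p :=
      (Dual.eval (ZMod p) V v) ∘ₗ L.dualAnnihilator.subtype
    have hg : g ≠ 0 := by
      intro h0
      obtain ⟨φ, hφv, hφL⟩ := Submodule.exists_le_ker_of_notMem hv.2
      exact hφv (DFunLike.congr_fun h0
        ⟨φ, (Submodule.mem_dualAnnihilator _).2 fun w hw => hφL hw⟩)
    have := exists_dual_apply_eq_zero_card g hg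
    rw [← Nat.card_eq_fintype_card, ← this]
    exact congrArg (p * ·) (Nat.subtype_card _ (fun φ => by simp [g])).symm
  have h1 : ∑ φ : L.dualAnnihilator, ((T ∩ LinearMap.ker φ.1) \ L).ncard =
      ∑ v ∈ (T \ L).toFinset,
        (Finset.univ.filter fun φ : L.dualAnnihilator => φ.1 v = 0).card := by
    refine (Finset.sum_congr rfl fun φ _ => ?_).trans
      (Finset.sum_card_bipartiteAbove_eq_sum_card_bipartiteBelow
        (fun (φ : L.dualAnnihilator) v => φ.1 v = 0))
    rw [Finset.bipartiteAbove, ← Set.ncard_coe_finset]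
    congr 1
    ext v
    simp
    tauto
  have h2 : ∑ φ : L.dualAnnihilator, (T \ L).ncard <
      ∑ φ : L.dualAnnihilator, p * ((T ∩ LinearMap.ker φ.1) \ L).ncard :=
    Finset.sum_lt_sum_of_nonempty ⟨0, Finset.mem_univ _⟩ fun φ _ => hcon φ
  rw [← Finset.mul_sum, h1, Finset.mul_sum, Finset.sum_congr rfl hcount, Finset.sum_const,
    Finset.sum_const, Finset.card_univ, smul_eq_mul, smul_eq_mul, ← Set.ncard_eq_toFinset_card',
    mul_comm] at h2
  exact lt_irrefl _ h2

end Averaging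

/-! ### The weight gap for general d. -/

section SmallWeight

variable {p : ℕ} [Fact p.Prime] {V : Type*} [AddCommGroup V] [Module (ZMod p) V]

theorem nzSupport_indicator (f : V → ZMod p) (H : Submodule (ZMod p) V) :
    nzSupport ((H : Set V).indicator f) = nzSupport f ∩ H := by
  classical
  ext v
  by_cases h : v ∈ H <;> simp [mem_nzSupport, h]

theorem indicator_apply_zero (f : V → ZMod p) (H : Submodule (ZMod p) V) :
    (H : Set V).indicator f 0 = f 0 :=
  Set.indicator_of_mem H.zero_mem f

theorem sub_one_dvd_ncard [Finite V] {X : Set V} (h0 : (0 : V) ∉ X)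
    (hX : ∀ a : ZMod p, a ≠ 0 → ∀ v ∈ X, a • v ∈ X) : p - 1 ∣ X.ncard := by
  have h := ncard_setOf_mk_mem (K := ZMod p) {P : Projectivization (ZMod p) V | P.rep ∈ X}
  rw [Nat.card_zmod] at h
  refine ⟨_, Eq.trans ?_ h⟩
  congr 1
  ext v
  constructor
  · intro hv
    have hv0 : v ≠ 0 := by rintro rfl; exact h0 hv
    obtain ⟨a, ha⟩ := Projectivization.exists_smul_eq_mk_rep (ZMod p) v hv0
    refine ⟨hv0, ?_⟩
    change (Projectivization.mk (ZMod p) v hv0).rep ∈ X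
    rw [← ha]
    exact hX a a.ne_zero v hv
  · rintro ⟨hv0, hv⟩
    obtain ⟨a, ha⟩ := Projectivization.exists_smul_eq_mk_rep (ZMod p) v hv0
    have h1 : (Projectivization.mk (ZMod p) v hv0).rep ∈ X := hv
    rw [← ha] at h1
    have := hX (a⁻¹ : (ZMod p)ˣ) (Units.ne_zero _) _ h1
    rwa [← Units.smul_def, inv_smul_smul] at this

/-- A support closed under addition is a subspace. -/
theorem exists_eq_smul_indicator {d : ℕ} {f : V → ZMod p} (hf : f ∈ subspaceCode p V d)
    (hconst : ∀ v ∈ nzSupport f, f v = f 0)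
    (hadd : ∀ u ∈ nzSupport f, ∀ v ∈ nzSupport f, u + v ≠ 0 → u + v ∈ nzSupport f) :
    ∃ U : Submodule (ZMod p) V, (U : Set V) = insert 0 (nzSupport f) ∧
      f = f 0 • (U : Set V).indicator 1 := by
  classical
  let U : Submodule (ZMod p) V :=
    { carrier := insert 0 (nzSupport f)
      zero_mem' := Set.mem_insert _ _
      add_mem' := by
        rintro u v (rfl | hu) (rfl | hv)
        · simp
        · rw [zero_add]; exact Or.inr hv
        · rw [add_zero]; exact Or.inr hu
        · by_cases h : u + v = 0
          · exact Or.inl h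
          · exact Or.inr (hadd u hu v hv h)
      smul_mem' := by
        rintro a v (rfl | hv)
        · rw [smul_zero]; exact Set.mem_insert _ _
        · by_cases ha : a = 0
          · rw [ha, zero_smul]; exact Set.mem_insert _ _
          · exact Or.inr ((smul_mem_nzSupport hf ha).2 hv) }
  have hU : (U : Set V) = insert 0 (nzSupport f) := rfl
  refine ⟨U, hU, ?_⟩
  funext v
  rw [hU, Pi.smul_apply, Set.indicator_apply]
  by_cases hv : v = 0
  · simp [hv]
  by_cases hvS : v ∈ nzSupport f
  · simp [hvS, hconst v hvS]
  · have : f v = 0 := by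
      by_contra h
      exact hvS ⟨hv, h⟩
    simp [hv, hvS, this]

variable [Finite V]

theorem ncard_inter_hyperplane (S : Set V) {L H : Submodule (ZMod p) V} (hLH : L ≤ H) :
    (S ∩ H).ncard = (S ∩ L).ncard + ((S ∩ H) \ L).ncard := by
  rw [← Set.ncard_inter_add_ncard_sdiff_eq_ncard (S ∩ H) (L : Set V), Set.inter_assoc,
    Set.inter_eq_right.2 (show (L : Set V) ⊆ H from hLH)]

/-- A codeword of small weight takes a single value on its support. -/
theorem apply_eq_apply_zero_of_small (e : ℕ) {f : V → ZMod p}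
    (hf : f ∈ subspaceCode p V (e + 2))
    (hcard : (nzSupport f).ncard + (p - 1) * p ^ e < (p - 1) * (2 * p ^ (e + 1) + 1))
    {u : V} (hu : u ∈ nzSupport f) : f u = f 0 := by
  classical
  have hp := (Fact.out : p.Prime).two_le
  -- The projective bound B_e = 2p^(e+1) - p^e + 1 satisfies B_(e+1) - 1 = p(B_e - 1): remove the
  -- point of u, divide by p, put it back. It starts at B_0 = 2p.
  induction e generalizing f with
  | zero =>
    obtain ⟨U, hU⟩ := eq_smul_indicator_of_ncard_lt_two hf (by
      simp only [pow_zero, zero_add, pow_one] at hcard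
      nlinarith)
    have h1 := congrFun hU u
    have h2 : u ∈ U := by
      by_contra h
      exact hu.2 (by rw [h1]; simp [h])
    rw [h1]
    simp [h2]
  | succ e ih =>
    obtain ⟨H, hLH, hH, hHc⟩ := exists_hyperplane_ge (nzSupport f) (Submodule.span (ZMod p) {u})
    have huH : u ∈ H := hLH (Submodule.mem_span_singleton_self u)
    have h1 := ih (indicator_subspaceCode hf H (by omega)) (by
      rw [nzSupport_indicator, ncard_inter_hyperplane _ hLH]
      have h2 := Set.ncard_inter_add_ncard_sdiff_eq_ncard (nzSupport f)
        (Submodule.span (ZMod p) {u} : Set V)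
      have h3 := ncard_submodule_diff_zero (Submodule.span (ZMod p) {u})
      rw [finrank_span_singleton hu.1, pow_one] at h3
      rw [nzSupport_inter_span_singleton hf hu] at h2 ⊢
      obtain ⟨r, rfl⟩ : ∃ r, p = r + 1 := ⟨p - 1, by omega⟩
      simp only [Nat.add_sub_cancel] at hcard ⊢
      have h4 : ((Submodule.span (ZMod (r + 1)) {u} : Set V) \ {0}).ncard = r := by omega
      rw [h4] at h2 ⊢
      rw [pow_succ _ (e + 1), pow_succ _ e] at hcard
      rw [pow_succ _ e]
      refine Nat.lt_of_mul_lt_mul_left (a := r + 1) ?_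
      nlinarith) (by rw [nzSupport_indicator]; exact ⟨hu, huH⟩)
    rwa [indicator_apply_zero, Set.indicator_of_mem (show u ∈ (H : Set V) from huH)] at h1

/-- If the plane spanned by two points of the support is not contained in the support, there are
not too many points of the support in it. -/
theorem ncard_nzSupport_inter_plane_le {d : ℕ} {f : V → ZMod p} (hf : f ∈ subspaceCode p V d)
    {u v : V} (huv : u + v ≠ 0) (huvS : u + v ∉ nzSupport f) :
    (nzSupport f ∩ (Submodule.span (ZMod p) {u, v} : Set V)).ncard ≤ (p - 1) * p := by
  classical
  set L := Submodule.span (ZMod p) {u, v} with hL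
  have hw : u + v ∈ L := add_mem (Submodule.subset_span (by simp)) (Submodule.subset_span (by simp))
  -- All of ⟨u + v⟩ misses the support, leaving at most p² - p vectors.
  have h1 : nzSupport f ∩ L ⊆ (L : Set V) \ (Submodule.span (ZMod p) {u + v} : Set V) := by
    rintro x ⟨hxS, hxL⟩
    refine ⟨hxL, fun hx => ?_⟩
    obtain ⟨a, rfl⟩ := Submodule.mem_span_singleton.1 hx
    have ha : a ≠ 0 := by
      rintro rfl
      exact hxS.1 (by simp)
    exact huvS ((smul_mem_nzSupport hf ha).1 hxS)
  have h2 := Set.ncard_le_ncard h1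
  have h3 := Set.ncard_sdiff_add_ncard_of_subset
    (show (Submodule.span (ZMod p) {u + v} : Set V) ⊆ L from
      (Submodule.span_singleton_le_iff_mem _ _).2 hw)
  rw [ncard_submodule, ncard_submodule, finrank_span_singleton huv] at h3
  have h4 : finrank (ZMod p) L ≤ 2 := by
    have := finrank_span_finset_le_card (R := ZMod p) ({u, v} : Finset V)
    rw [Finset.coe_pair] at this
    exact this.trans Finset.card_le_two
  have h5 := Nat.pow_le_pow_right (Fact.out : p.Prime).pos h4
  obtain ⟨r, rfl⟩ : ∃ r, p = r + 1 := ⟨p - 1, by have := (Fact.out : p.Prime).two_le; omega⟩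
  rw [Nat.add_sub_cancel]
  nlinarith

/-- For the code of points and planes, a line through two points of the support misses at most one
point of the support. -/
theorem ncard_nzSupport_inter_plane_eq {f : V → ZMod p} (hf : f ∈ subspaceCode p V 3)
    (hconst : ∀ v ∈ nzSupport f, f v = f 0)
    (hcard : (nzSupport f).ncard < (p - 1) * (2 * p ^ 2))
    {u v : V} (hu : u ∈ nzSupport f) (hv : v ∈ nzSupport f) (huv : u + v ≠ 0)
    (huvS : u + v ∉ nzSupport f) :
    (nzSupport f ∩ (Submodule.span (ZMod p) {u, v} : Set V)).ncard = (p - 1) * p := by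
  classical
  have hp := (Fact.out : p.Prime).two_le
  have hle := ncard_nzSupport_inter_plane_le hf huv huvS
  have hvu : v ∉ Submodule.span (ZMod p) {u} := by
    intro h
    obtain ⟨a, rfl⟩ := Submodule.mem_span_singleton.1 h
    have h1 : u + a • u = (1 + a) • u := by module
    rw [h1] at huv huvS
    exact huvS ((smul_mem_nzSupport hf (fun h => huv (by rw [h, zero_smul]))).2 hu)
  have hpl : p ≤ (nzSupport f ∩ (Submodule.span (ZMod p) {u, v} : Set V)).ncard := by
    have h1 : insert v (nzSupport f ∩ (Submodule.span (ZMod p) {u} : Set V)) ⊆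
        nzSupport f ∩ (Submodule.span (ZMod p) {u, v} : Set V) := by
      rw [Set.insert_subset_iff]
      exact ⟨⟨hv, Submodule.subset_span (by simp)⟩,
        Set.inter_subset_inter_right _ (Submodule.span_mono (by simp))⟩
    have h2 := Set.ncard_le_ncard h1
    rw [Set.ncard_insert_of_notMem (fun h => hvu h.2), nzSupport_inter_span_singleton hf hu,
      ncard_submodule_diff_zero, finrank_span_singleton hu.1, pow_one] at h2
    exact h2
  set L := Submodule.span (ZMod p) {u, v} with hL
  -- Averaging twice gives codimension at most 2 < 3, so sums over H ⊓ H' vanish, while the part of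
  -- the support off L shrinks by p².
  obtain ⟨H, hLH, hH, hHc⟩ := exists_hyperplane_ge (nzSupport f) L
  obtain ⟨H', hLH', hH', hHc'⟩ := exists_hyperplane_ge (nzSupport f ∩ H) L
  have hLW : L ≤ H ⊓ H' := le_inf hLH hLH'
  have hW : finrank (ZMod p) V ≤ finrank (ZMod p) (H ⊓ H' : Submodule (ZMod p) V) + 2 := by
    have h1 := Submodule.finrank_sup_add_finrank_inf_eq H H'
    have h2 := Submodule.finrank_le (H ⊔ H')
    omega
  have hWS := ncard_inter_hyperplane (nzSupport f) hLW
  have hsum := apply_zero_add_ncard_mul_eq_zero hf (H ⊓ H') (by omega)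
    (fun v hv _ => hconst v hv)
  rw [Submodule.coe_inf, ← Set.inter_assoc] at hWS hsum
  have hf0 : f 0 ≠ 0 := by rw [← hconst u hu]; exact hu.2
  have hdvd : p ∣ (nzSupport f ∩ H ∩ H').ncard + 1 := by
    rw [← CharP.cast_eq_zero_iff (ZMod p) p]
    refine (mul_eq_zero.1 (?_ : (_ : ZMod p) * f 0 = 0)).resolve_right hf0
    push_cast
    linear_combination hsum
  obtain ⟨σ, hσ⟩ := sub_one_dvd_ncard (p := p) (X := nzSupport f ∩ L)
    (fun h => h.1.1 rfl) (fun a ha v hv =>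
      ⟨(smul_mem_nzSupport hf ha).2 hv.1, L.smul_mem a hv.2⟩)
  obtain ⟨τ, hτ⟩ := sub_one_dvd_ncard (p := p) (X := (nzSupport f ∩ H ∩ H') \ L)
    (fun h => h.2 L.zero_mem) (fun a ha v hv =>
      ⟨⟨⟨(smul_mem_nzSupport hf ha).2 hv.1.1.1, H.smul_mem a hv.1.1.2⟩,
        H'.smul_mem a hv.1.2⟩, fun h => hv.2 ((L.smul_mem_iff ha).1 h)⟩)
  have hSL : (nzSupport f \ L).ncard ≤ (nzSupport f).ncard := Set.ncard_le_ncard Set.sdiff_subset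
  rw [hWS, hσ, hτ] at hdvd
  rw [hτ] at hHc'
  rw [hσ] at hle hpl ⊢
  obtain ⟨r, rfl⟩ : ∃ r, p = r + 1 := ⟨p - 1, by omega⟩
  simp only [Nat.add_sub_cancel] at *
  have hr : 0 < r := by omega
  have hσ1 : 2 ≤ σ := by
    by_contra h
    have : r * σ ≤ r * 1 := Nat.mul_le_mul_left _ (by omega)
    omega
  have hσ2 : σ ≤ r + 1 := Nat.le_of_mul_le_mul_left hle hr
  have hτ1 : τ < 2 := by
    by_contra! h
    have h1 : r * 2 ≤ r * τ := Nat.mul_le_mul_left _ h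
    have h2 := Nat.mul_le_mul_left ((r + 1) * (r + 1)) h1
    have h3 := Nat.mul_le_mul_left (r + 1) hHc'
    nlinarith
  -- Here σ and τ count support points on L and on the rest of H ⊓ H'. The vanishing sum says σ + τ
  -- ≡ 1 mod p; with 2 ≤ σ ≤ p and τ ≤ 1 this leaves only σ = p, τ = 1.
  have hdvd' : r + 1 ∣ σ + τ - 1 := by
    have h1 : (r * σ + r * τ + 1) + (σ + τ - 1) = (r + 1) * (σ + τ) := by
      zify [show 1 ≤ σ + τ by omega]
      ring
    exact (Nat.dvd_add_right hdvd).1 (h1 ▸ dvd_mul_right _ _)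
  have := Nat.le_of_dvd (by omega) hdvd'
  congr 1
  by_contra hne
  have hστ : σ = r + 1 ∨ (σ = r ∧ τ = 2) := by omega
  omega

/-- The support of a codeword of small weight and constant value is closed under addition, for the
code of points and planes. -/
theorem add_mem_nzSupport_three {f : V → ZMod p} (hf : f ∈ subspaceCode p V 3)
    (hconst : ∀ v ∈ nzSupport f, f v = f 0)
    (hcard : (nzSupport f).ncard < (p - 1) * (2 * p ^ 2))
    {u v : V} (hu : u ∈ nzSupport f) (hv : v ∈ nzSupport f) (huv : u + v ≠ 0) :
    u + v ∈ nzSupport f := by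
  classical
  by_contra huvS
  have hp := (Fact.out : p.Prime).two_le
  have hLc := ncard_nzSupport_inter_plane_eq hf hconst hcard hu hv huv huvS
  have hvu : v ∉ Submodule.span (ZMod p) {u} := by
    intro h
    obtain ⟨a, rfl⟩ := Submodule.mem_span_singleton.1 h
    have h1 : u + a • u = (1 + a) • u := by module
    rw [h1] at huv huvS
    exact huvS ((smul_mem_nzSupport hf (fun h => huv (by rw [h, zero_smul]))).2 hu)
  have hL2 := finrank_span_pair_eq_two hu.1 hvu
  set L := Submodule.span (ZMod p) {u, v} with hL
  have hw : u + v ∈ L := add_mem (Submodule.subset_span (by simp)) (Submodule.subset_span (by simp))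
  have hf0 : f 0 ≠ 0 := by rw [← hconst u hu]; exact hu.2
  obtain ⟨H, hLH, hH, hHc⟩ := exists_hyperplane_ge (nzSupport f) L
  -- L misses exactly one support point, so subtracting it trades p points for one. The result has
  -- weight below 2p and vanishes at 0, so it must be 0, yet its value at u + v is -f 0.
  set g := (H : Set V).indicator f - f 0 • (L : Set V).indicator 1 with hg
  have hgmem : g ∈ subspaceCode p V 2 :=
    sub_mem (indicator_subspaceCode hf H (by omega))
      (Submodule.smul_mem _ _ (indicator_mem_subspaceCode hL2.ge))
  have hgS : nzSupport g ⊆ ((nzSupport f ∩ H) \ L) ∪ (((L : Set V) \ {0}) \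
      (nzSupport f ∩ L)) := by
    intro x hx
    by_cases hxL : x ∈ L
    · refine Or.inr ⟨⟨hxL, hx.1⟩, fun h => hx.2 ?_⟩
      simp [hg, hLH hxL, hxL, hconst x h.1]
    · refine Or.inl ⟨?_, hxL⟩
      have h2 := hx.2
      by_cases hxH : x ∈ H
      · refine ⟨⟨hx.1, fun h => h2 ?_⟩, hxH⟩
        simp [hg, hxL, h]
      · simp [hg, hxL, hxH] at h2
  have hgc : (nzSupport g).ncard < 2 * p * (p - 1) := by
    have h1 := (Set.ncard_le_ncard hgS).trans (Set.ncard_union_le _ _)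
    have h2 := Set.ncard_sdiff_add_ncard_of_subset
      (show nzSupport f ∩ L ⊆ (L : Set V) \ {0} from fun x hx => ⟨hx.2, hx.1.1⟩)
    have h3 := ncard_submodule_diff_zero L
    have h4 := Set.ncard_inter_add_ncard_sdiff_eq_ncard (nzSupport f) (L : Set V)
    rw [hL2] at h3
    rw [hLc] at h2 h4
    refine h1.trans_lt ?_
    clear_value g
    obtain ⟨r, rfl⟩ : ∃ r, p = r + 1 := ⟨p - 1, by omega⟩
    simp only [Nat.add_sub_cancel] at hcard h2 h4 ⊢
    have h5 : (((L : Set V) \ {0}) \ (nzSupport f ∩ L)).ncard = r := by nlinarith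
    rw [h5]
    refine Nat.lt_of_mul_lt_mul_left (a := r + 1) ?_
    nlinarith
  obtain ⟨U, hU⟩ := eq_smul_indicator_of_ncard_lt_two hgmem hgc
  have hg0 : g 0 = 0 := by simp [hg]
  rw [hg0, zero_smul] at hU
  have h1 := congrFun hU (u + v)
  have h2 : f (u + v) = 0 := by
    by_contra h
    exact huvS ⟨huv, h⟩
  simp [hg, hw, hLH hw, h2, hf0] at h1

/-- The support of a codeword of small weight and constant value is closed under addition. -/
theorem add_mem_nzSupport_of_small (e : ℕ) {f : V → ZMod p}
    (hf : f ∈ subspaceCode p V (e + 3)) (hconst : ∀ v ∈ nzSupport f, f v = f 0)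
    (hcard : (nzSupport f).ncard + (p - 1) * p ^ (e + 1) < (p - 1) * (2 * p ^ (e + 2) + p))
    {u v : V} (hu : u ∈ nzSupport f) (hv : v ∈ nzSupport f) (huv : u + v ≠ 0) :
    u + v ∈ nzSupport f := by
  have hp := (Fact.out : p.Prime).two_le
  -- As for constancy of values, but now the plane ⟨u, v⟩ is kept, carrying at most p support
  -- points; hence + p in place of + 1.
  induction e generalizing f with
  | zero =>
    refine add_mem_nzSupport_three hf hconst ?_ hu hv huv
    simp only [zero_add, pow_one] at hcard
    nlinarith
  | succ e ih =>
    by_contra huvS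
    have hLc := ncard_nzSupport_inter_plane_le hf huv huvS
    obtain ⟨H, hLH, hH, hHc⟩ := exists_hyperplane_ge (nzSupport f)
      (Submodule.span (ZMod p) {u, v})
    have huH : u ∈ H := hLH (Submodule.subset_span (by simp))
    have hvH : v ∈ H := hLH (Submodule.subset_span (by simp))
    have hS := nzSupport_indicator f H
    refine huvS ((hS ▸ ih (indicator_subspaceCode hf H (by omega)) ?_ ?_ ?_ ?_ :
      u + v ∈ nzSupport f ∩ H).1)
    · intro x hx
      rw [hS] at hx
      rw [indicator_apply_zero, Set.indicator_of_mem hx.2]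
      exact hconst x hx.1
    · rw [hS, ncard_inter_hyperplane _ hLH]
      have h4 := Set.ncard_inter_add_ncard_sdiff_eq_ncard (nzSupport f)
        (Submodule.span (ZMod p) {u, v} : Set V)
      obtain ⟨r, rfl⟩ : ∃ r, p = r + 1 := ⟨p - 1, by omega⟩
      simp only [Nat.add_sub_cancel] at hcard hLc ⊢
      rw [show e + 1 + 2 = (e + 2) + 1 from rfl, pow_succ _ (e + 2), pow_succ _ (e + 1)] at hcard
      rw [pow_succ _ (e + 1)]
      refine Nat.lt_of_mul_lt_mul_left (a := r + 1) ?_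
      have h5 := Nat.mul_le_mul_left r hLc
      nlinarith
    · rw [hS]; exact ⟨hu, huH⟩
    · rw [hS]; exact ⟨hv, hvH⟩

/-- The gap in the weight distribution above the minimum weight. -/
theorem ncard_nzSupport_of_small (hp3 : 3 ≤ p) (e : ℕ) {f : V → ZMod p}
    (hf : f ∈ subspaceCode p V (e + 2)) (hne : (nzSupport f).Nonempty)
    (hcard : (nzSupport f).ncard + (p - 1) * p ^ e < (p - 1) * (2 * p ^ (e + 1) + 1)) :
    (nzSupport f).ncard + 1 = p ^ (e + 2) := by
  have hU : ∃ U : Submodule (ZMod p) V, f = f 0 • (U : Set V).indicator 1 := by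
    cases e with
    | zero =>
      refine eq_smul_indicator_of_ncard_lt_two hf ?_
      simp only [pow_zero, zero_add, pow_one] at hcard
      nlinarith
    | succ e =>
      have hconst := fun v hv => apply_eq_apply_zero_of_small (e + 1) hf hcard (u := v) hv
      obtain ⟨U, -, hU⟩ := exists_eq_smul_indicator hf hconst fun u hu v hv huv =>
        add_mem_nzSupport_of_small e hf hconst
          (hcard.trans_le (Nat.mul_le_mul_left _ (by
            rw [show e + 1 + 1 = e + 2 from rfl]; omega))) hu hv huv
      exact ⟨U, hU⟩
  obtain ⟨U, hU⟩ := hU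
  have hf0 : f 0 ≠ 0 := by
    obtain ⟨v, hv⟩ := hne
    intro h0
    rw [h0, zero_smul] at hU
    exact hv.2 (by rw [hU]; rfl)
  have hS : nzSupport f = (U : Set V) \ {0} := by
    ext v
    by_cases hv : v ∈ U
    · have : f v = f 0 := by rw [hU]; simp [hv]
      simp [mem_nzSupport, this, hf0, hv]
    · have : f v = 0 := by rw [hU]; simp [hv]
      simp [mem_nzSupport, this, hv]
  have h1 := pow_le_ncard_nzSupport hf hne
  have h2 := ncard_submodule_diff_zero U
  rw [← hS] at h2
  rw [h2] at h1 ⊢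
  congr 1
  refine le_antisymm ?_ ((Nat.pow_le_pow_iff_right (by omega)).1 h1)
  -- A subspace of dimension e + 3 or more has too many vectors for the weight bound.
  by_contra! hlt
  have h3 := Nat.pow_le_pow_right (show 0 < p by omega) (show e + 3 ≤ _ from hlt)
  obtain ⟨r, rfl⟩ : ∃ r, p = r + 1 := ⟨p - 1, by omega⟩
  simp only [Nat.add_sub_cancel] at hcard
  have h4 : (r + 1) ^ (e + 3) = (r + 1) ^ 3 * (r + 1) ^ e := by ring
  have h5 : (r + 1) ^ (e + 1) = (r + 1) * (r + 1) ^ e := by ring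
  have h6 : 1 ≤ (r + 1) ^ e := Nat.one_le_pow _ _ (by omega)
  rw [h4] at h3
  rw [h5] at hcard
  generalize (r + 1) ^ e = x at *
  nlinarith [Nat.mul_le_mul_left (r * r) h6, Nat.mul_le_mul_left (r * r * r) h6]

end SmallWeight

/-! ### Transfer to C_k(n,q). -/

section ProjectiveCode

variable {p h n k : ℕ} [Fact p.Prime] {F : Type*} [Field F] [Fintype F] [Algebra (ZMod p) F]

theorem theta_mul_sub_one_add_one {q : ℕ} (hq : 2 ≤ q) (m : ℕ) :
    (q - 1) * theta q m + 1 = q ^ (m + 1) := by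
  have h1 : q - 1 ∣ q ^ (m + 1) - 1 := by simpa using Nat.sub_dvd_pow_sub_pow q 1 (m + 1)
  rw [theta, Nat.mul_div_cancel' h1, Nat.sub_add_cancel (Nat.one_le_pow _ _ (by omega))]

theorem finrank_eq_of_card_eq_pow (hF : Fintype.card F = p ^ h) : finrank (ZMod p) F = h := by
  have h1 := card_eq_pow_finrank (K := ZMod p) (V := F)
  rw [ZMod.card, hF] at h1
  exact (Nat.pow_right_injective (Fact.out : p.Prime).two_le h1).symm

/-- A codeword of `C_k(n,q)` is induced by a codeword of the code spanned by the
`𝔽_p`-subspaces of dimension `h * (k + 1)` of `𝔽_q^(n+1)`. -/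
theorem exists_lift_mem_subspaceCode (hF : Fintype.card F = p ^ h) {c : PGPoint n F → ZMod p}
    (hc : c ∈ pgCode p n k F) :
    ∃ f ∈ subspaceCode p (Fin (n + 1) → F) (h * (k + 1)),
      ∀ (v : Fin (n + 1) → F) (hv : v ≠ 0), f v = c (Projectivization.mk F v hv) := by
  classical
  induction hc using Submodule.span_induction with
  | mem x hx =>
    obtain ⟨⟨K, hK⟩, rfl⟩ := hx
    refine ⟨_, indicator_mem_subspaceCode
      (U := (Projectivization.Subspace.submodule K).restrictScalars (ZMod p)) ?_, ?_⟩
    · have h1 := finrank_mul_finrank (ZMod p) F (Projectivization.Subspace.submodule K)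
      rw [finrank_eq_of_card_eq_pow hF, show finrank F _ = k + 1 from hK] at h1
      exact h1.le
    · intro v hv
      have h1 := Projectivization.Subspace.mem_submodule_iff K hv
      change _ = incidenceVector p (K : Set (PGPoint n F)) _
      rw [incidenceVector, Set.indicator_apply, Set.indicator_apply]
      exact if_congr h1 rfl rfl
  | zero => exact ⟨0, zero_mem _, fun _ _ => rfl⟩
  | add x y _ _ hx hy =>
    obtain ⟨f, hf, hfx⟩ := hx
    obtain ⟨g, hg, hgy⟩ := hy
    exact ⟨f + g, add_mem hf hg, fun v hv => by simp [hfx v hv, hgy v hv]⟩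
  | smul b x _ hx =>
    obtain ⟨f, hf, hfx⟩ := hx
    exact ⟨b • f, Submodule.smul_mem _ _ hf, fun v hv => by simp [hfx v hv]⟩

omit [Algebra (ZMod p) F] in
theorem ncard_nzSupport_lift {c : PGPoint n F → ZMod p} {f : (Fin (n + 1) → F) → ZMod p}
    (hfc : ∀ (v : Fin (n + 1) → F) (hv : v ≠ 0), f v = c (Projectivization.mk F v hv)) :
    (nzSupport f).ncard = (Fintype.card F - 1) * weight c := by
  rw [weight, ← Nat.card_eq_fintype_card, ← ncard_setOf_mk_mem]
  congr 1
  ext v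
  constructor
  · rintro ⟨hv, hfv⟩
    exact ⟨hv, by rwa [Function.mem_support, ← hfc v hv]⟩
  · rintro ⟨hv, hcv⟩
    exact ⟨hv, by rwa [hfc v hv]⟩

omit [Fintype F] [Algebra (ZMod p) F] in
theorem nzSupport_lift_nonempty {c : PGPoint n F → ZMod p} {f : (Fin (n + 1) → F) → ZMod p}
    (hfc : ∀ (v : Fin (n + 1) → F) (hv : v ≠ 0), f v = c (Projectivization.mk F v hv))
    (hc : c ≠ 0) : (nzSupport f).Nonempty := by
  obtain ⟨P, hP⟩ := Function.ne_iff.1 hc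
  refine ⟨P.rep, P.rep_nonzero, ?_⟩
  rw [hfc _ P.rep_nonzero, Projectivization.mk_rep]
  exact hP

omit [Fact p.Prime] [Algebra (ZMod p) F] in
theorem two_le_pow_of_card (hF : Fintype.card F = p ^ h) : 2 ≤ p ^ h := by
  rw [← hF]
  exact Fintype.one_lt_card

/-- The minimum weight of `C_k(n,q)` is at least `θ_k`. -/
theorem theta_le_weight (hF : Fintype.card F = p ^ h) {c : PGPoint n F → ZMod p}
    (hc : c ∈ pgCode p n k F) (hc0 : c ≠ 0) : theta (p ^ h) k ≤ weight c := by
  obtain ⟨f, hf, hfc⟩ := exists_lift_mem_subspaceCode hF hc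
  have h1 := pow_le_ncard_nzSupport hf (nzSupport_lift_nonempty hfc hc0)
  have h2 := two_le_pow_of_card hF
  rw [ncard_nzSupport_lift hfc, hF, pow_mul, ← theta_mul_sub_one_add_one h2] at h1
  exact Nat.le_of_mul_le_mul_left (Nat.le_of_add_le_add_right h1) (by omega)

/-- The codewords of weight `θ_k` are the multiples of the incidence vectors of `k`-spaces. -/
theorem exists_eq_smul_incidenceVector (hF : Fintype.card F = p ^ h) {c : PGPoint n F → ZMod p}
    (hc : c ∈ pgCode p n k F) (hw : weight c = theta (p ^ h) k) :
    ∃ (a : ZMod p) (K : PGSubspace n F), a ≠ 0 ∧ IsSpaceOfDim k K ∧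
      c = a • incidenceVector p (K : Set (PGPoint n F)) := by
  classical
  obtain ⟨f, hf, hfc⟩ := exists_lift_mem_subspaceCode hF hc
  have h2 := two_le_pow_of_card hF
  have hS : (nzSupport f).ncard + 1 = (p ^ h) ^ (k + 1) := by
    rw [ncard_nzSupport_lift hfc, hF, hw, theta_mul_sub_one_add_one h2]
  have hlt : (nzSupport f).ncard < p ^ (h * (k + 1)) := by
    rw [pow_mul, ← hS]
    exact Nat.lt_succ_self _
  have hne : (nzSupport f).Nonempty := by
    rw [Set.nonempty_iff_ne_empty]
    intro h0
    rw [h0, Set.ncard_empty, zero_add] at hS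
    have := Nat.one_lt_pow (show k + 1 ≠ 0 by omega) (show 1 < p ^ h by omega)
    omega
  have hconst : ∀ v ∈ nzSupport f, f v = f 0 :=
    fun v hv => apply_eq_apply_zero_of_ncard_lt hf hlt hv
  -- Additive closure comes from minimality, and closure under F because `f` is constant on the
  -- nonzero vectors of each point.
  let M : Submodule F (Fin (n + 1) → F) :=
    { carrier := insert 0 (nzSupport f)
      zero_mem' := Set.mem_insert _ _
      add_mem' := by
        rintro u v (rfl | hu) (rfl | hv)
        · simp
        · rw [zero_add]; exact Or.inr hv
        · rw [add_zero]; exact Or.inr hu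
        · by_cases huv : u + v = 0
          · exact Or.inl huv
          · exact Or.inr (add_mem_nzSupport_of_ncard_lt hf hlt hu hv huv)
      smul_mem' := by
        rintro a v (rfl | hv)
        · rw [smul_zero]; exact Set.mem_insert _ _
        · by_cases ha : a = 0
          · rw [ha, zero_smul]; exact Set.mem_insert _ _
          · have hav : a • v ≠ 0 := smul_ne_zero ha hv.1
            refine Or.inr ⟨hav, ?_⟩
            have h1 : Projectivization.mk F (a • v) hav = Projectivization.mk F v hv.1 :=
              (Projectivization.mk_eq_mk_iff' F _ _ _ _).2 ⟨a, rfl⟩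
            rw [hfc _ hav, h1, ← hfc]
            exact hv.2 }
  have hM : (M : Set (Fin (n + 1) → F)) = insert 0 (nzSupport f) := rfl
  refine ⟨f 0, M.projectivization, ?_, ?_, ?_⟩
  · obtain ⟨v, hv⟩ := hne
    rw [← hconst v hv]
    exact hv.2
  · rw [IsSpaceOfDim, OrderIso.apply_symm_apply]
    have h1 : Nat.card M = (p ^ h) ^ (k + 1) := by
      have h3 : Nat.card M = (M : Set (Fin (n + 1) → F)).ncard := Nat.card_coe_set_eq _
      rw [h3, hM, Set.ncard_insert_of_notMem (fun h => h.1 rfl), hS]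
    rw [natCard_eq_pow_finrank (K := F), Nat.card_eq_fintype_card, hF] at h1
    exact Nat.pow_right_injective h2 h1
  · funext P
    induction P using Projectivization.ind with
    | h v hv =>
      rw [Pi.smul_apply, incidenceVector, Set.indicator_apply, ← hfc v hv]
      have h1 : Projectivization.mk F v hv ∈ (M.projectivization : Set (PGPoint n F)) ↔
          v ∈ nzSupport f := by
        rw [SetLike.mem_coe, Submodule.mk_mem_projectivization_iff, ← SetLike.mem_coe, hM]
        simp [hv]
      by_cases hvS : v ∈ nzSupport f
      · simp [h1, hvS, hconst v hvS]
      · have : f v = 0 := by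
          by_contra h0
          exact hvS ⟨hv, h0⟩
        simp [h1, hvS, this]

omit [Fact p.Prime] [Fintype F] [Algebra (ZMod p) F] in
theorem incidenceVector_mem_pgCode {K : PGSubspace n F} (hK : IsSpaceOfDim k K) :
    incidenceVector p (K : Set (PGPoint n F)) ∈ pgCode p n k F :=
  Submodule.subset_span ⟨⟨K, hK⟩, rfl⟩

omit [Algebra (ZMod p) F] in
theorem weight_smul_incidenceVector (hF : Fintype.card F = p ^ h) {a : ZMod p} (ha : a ≠ 0)
    {K : PGSubspace n F} (hK : IsSpaceOfDim k K) :
    weight (a • incidenceVector p (K : Set (PGPoint n F))) = theta (p ^ h) k := by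
  classical
  have h2 := two_le_pow_of_card hF
  have h1 : Function.support (a • incidenceVector p (K : Set (PGPoint n F))) = K := by
    ext P
    simp [incidenceVector, ha]
  rw [weight, h1]
  have h3 := ncard_setOf_mk_mem (K := F) (K : Set (PGPoint n F))
  have h4 : {v : Fin (n + 1) → F | ∃ hv : v ≠ 0, Projectivization.mk F v hv ∈
      (K : Set (PGPoint n F))} = (Projectivization.Subspace.submodule K : Set _) \ {0} := by
    ext v
    constructor
    · rintro ⟨hv, h⟩
      exact ⟨(Projectivization.Subspace.mem_submodule_iff K hv).2 h, hv⟩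
    · rintro ⟨h, hv⟩
      exact ⟨hv, (Projectivization.Subspace.mem_submodule_iff K hv).1 h⟩
  have h5 := Set.ncard_sdiff_singleton_add_one
    (s := (Projectivization.Subspace.submodule K : Set (Fin (n + 1) → F))) (a := 0)
    (Submodule.zero_mem _)
  have h6 : (Projectivization.Subspace.submodule K : Set (Fin (n + 1) → F)).ncard =
      Nat.card (Projectivization.Subspace.submodule K) := (Nat.card_coe_set_eq _).symm
  have h7 : Nat.card (Projectivization.Subspace.submodule K) = (p ^ h) ^ (k + 1) := by
    rw [natCard_eq_pow_finrank (K := F), show finrank F _ = k + 1 from hK,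
      Nat.card_eq_fintype_card, hF]
  rw [← h4, h3, h6, h7, Nat.card_eq_fintype_card, hF, ← theta_mul_sub_one_add_one h2] at h5
  exact Nat.eq_of_mul_eq_mul_left (show 0 < p ^ h - 1 by omega) (Nat.succ_injective h5)

omit [Fintype F] in
theorem exists_isSpaceOfDim (hkn : k ≤ n) : ∃ K : PGSubspace n F, IsSpaceOfDim k K := by
  let v : Fin (k + 1) → (Fin (n + 1) → F) :=
    Pi.basisFun F (Fin (n + 1)) ∘ Fin.castLE (Nat.succ_le_succ hkn)
  have hv : LinearIndependent F v :=
    (Pi.basisFun F (Fin (n + 1))).linearIndependent.comp _ (Fin.castLE_injective _)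
  refine ⟨(Submodule.span F (Set.range v)).projectivization, ?_⟩
  rw [IsSpaceOfDim, OrderIso.apply_symm_apply, finrank_span_eq_card hv, Fintype.card_fin]

-- After multiplying by 7, the leading terms compare as 12p^(e+2) against 14p^(e+2) - 21p^(e+1),
-- which needs 2p > 21. The last hypothesis controls the leftover 5(q-1).
omit [Fact p.Prime] in
theorem small_weight_bound {e N q θ w : ℕ} (hp : 11 ≤ p) (hN : N = (q - 1) * w)
    (hθ : (q - 1) * θ + 1 = p ^ (e + 2)) (hq : 1 ≤ q) (hw : 7 * w < 12 * θ + 6)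
    (hqe : e = 0 ∧ q = p ∨ p * q ≤ p ^ (e + 1)) :
    N + (p - 1) * p ^ e < (p - 1) * (2 * p ^ (e + 1) + 1) := by
  obtain ⟨s, rfl⟩ : ∃ s, q = s + 1 := ⟨q - 1, by omega⟩
  obtain ⟨r, hr⟩ : ∃ r, p = r + 11 := ⟨p - 11, by omega⟩
  rw [show p - 1 = r + 10 by omega]
  rw [Nat.add_sub_cancel] at hN hθ
  have h1 : 7 * N ≤ 12 * (s * θ) + 5 * s := by
    rw [hN]
    have := Nat.mul_le_mul_left s (show 7 * w ≤ 12 * θ + 5 by omega)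
    nlinarith
  have h2 : p ^ (e + 1) = (r + 11) * p ^ e := by rw [pow_succ, mul_comm, ← hr]
  have h3 : p ^ (e + 2) = (r + 11) * ((r + 11) * p ^ e) := by rw [pow_succ, h2, mul_comm, ← hr]
  rw [h3] at hθ
  rw [h2] at hqe ⊢
  have hx : 1 ≤ p ^ e := Nat.one_le_pow _ _ (by omega)
  rcases hqe with ⟨rfl, hqp⟩ | hqe
  · rw [pow_zero] at *
    nlinarith
  · generalize p ^ e = x at *
    rw [hr] at hqe
    have h4 : s + 1 ≤ x := Nat.le_of_mul_le_mul_left hqe (by omega)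
    nlinarith [Nat.zero_le (r * x), Nat.zero_le (r * r * x)]

/-- There are no codewords of `C_k(n,q)`, `k ≥ 1`, with weight in the interval. -/
theorem weight_gap (hF : Fintype.card F = p ^ h) (hp : 7 < p) (hk : 1 ≤ k)
    {c : PGPoint n F → ZMod p} (hc : c ∈ pgCode p n k F)
    (hw : 7 * weight c < 12 * theta (p ^ h) k + 6) : weight c ≤ theta (p ^ h) k := by
  by_cases hc0 : c = 0
  · simp [hc0, weight]
  have hpp : p.Prime := Fact.out
  have hp11 : 11 ≤ p := by
    by_contra! hlt
    interval_cases p <;> revert hpp <;> decide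
  obtain ⟨f, hf, hfc⟩ := exists_lift_mem_subspaceCode hF hc
  have hne := nzSupport_lift_nonempty hfc hc0
  have h2 := two_le_pow_of_card hF
  have hh : h ≠ 0 := by
    rintro rfl
    simp at h2
  have hhk : h ≤ h * k := Nat.le_mul_of_pos_right h hk
  have hmul : h * (k + 1) = h * k + h := by ring
  have hθ := theta_mul_sub_one_add_one h2 k
  rw [← pow_mul] at hθ
  obtain ⟨e, he⟩ : ∃ e, h * (k + 1) = e + 2 := ⟨h * (k + 1) - 2, by omega⟩
  -- The first alternative is h = k = 1; otherwise hk ≥ 2.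
  have hqe : e = 0 ∧ p ^ h = p ∨ p * p ^ h ≤ p ^ (e + 1) := by
    by_cases h1 : h + 1 ≤ e + 1
    · right
      rw [← pow_succ']
      exact Nat.pow_le_pow_right (by omega) h1
    · left
      have h3 : h = 1 := by omega
      exact ⟨by omega, by rw [h3, pow_one]⟩
  have hS := ncard_nzSupport_lift hfc
  rw [hF] at hS
  rw [he] at hf hθ
  have h3 := ncard_nzSupport_of_small (by omega) e hf hne
    (small_weight_bound hp11 hS hθ (by omega) hw hqe)
  rw [hS, ← hθ] at h3
  exact (Nat.eq_of_mul_eq_mul_left (show 0 < p ^ h - 1 by omega) (Nat.succ_injective h3)).le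

omit [Fact p.Prime] [Algebra (ZMod p) F] in
theorem weight_le_one_of_dim_zero (c : PGPoint 0 F → ZMod p) : weight c ≤ 1 := by
  have h1 := Projectivization.card F (Fin (0 + 1) → F)
  have h2 : 1 < Nat.card F := Finite.one_lt_card
  have h4 : Nat.card (Fin (0 + 1) → F) = Nat.card F := by simp
  rw [h4] at h1
  have h3 : Nat.card (PGPoint 0 F) = 1 :=
    (Nat.eq_of_mul_eq_mul_right (show 0 < Nat.card F - 1 by omega) (by rw [one_mul]; exact h1)).symm
  rw [← h3, weight]
  exact Set.ncard_le_card _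

end ProjectiveCode

/-- Small weight codewords of `C_k(n,q)`. The first part is proved in the stronger form of
`weight_gap`: there are no codewords with weight in the given interval, so in particular none that
is a multiple of the incidence vector of a linear blocking set. -/
theorem mainTheorem7 (p h n k : ℕ) [Fact p.Prime] (F : Type*) [Field F] [Fintype F]
    [Algebra (ZMod p) F] (hF : Fintype.card F = p ^ h) (hkn : k ≤ n) :
    ((n : ℚ) / 2 ≤ k → 7 < p →
      ∀ c ∈ pgCode p n k F,
        (theta (p ^ h) k : ℚ) < weight c →
        (weight c : ℚ) < (12 * (theta (p ^ h) k : ℚ) + 6) / 7 →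
        ∃ (a : ZMod p) (B : Set (PGPoint n F)), a ≠ 0 ∧ IsBlockingSet k B ∧
          ¬ IsLinearBlockingSet p h k B ∧ c = a • incidenceVector p B) ∧
    (IsLeast {w : ℕ | ∃ c ∈ pgCode p n k F, c ≠ 0 ∧ weight c = w} (theta (p ^ h) k) ∧
      ∀ c : PGPoint n F → ZMod p,
        (c ∈ pgCode p n k F ∧ weight c = theta (p ^ h) k) ↔
          ∃ (a : ZMod p) (K : PGSubspace n F), a ≠ 0 ∧ IsSpaceOfDim k K ∧
            c = a • incidenceVector p (K : Set (PGPoint n F))) := by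
  have h2 := two_le_pow_of_card hF
  have hθ0 : 0 < theta (p ^ h) k := by
    rw [Nat.pos_iff_ne_zero]
    intro h0
    have h1 := theta_mul_sub_one_add_one h2 k
    rw [h0, mul_zero, zero_add] at h1
    have := Nat.one_lt_pow (show k + 1 ≠ 0 by omega) (show 1 < p ^ h by omega)
    omega
  refine ⟨fun hnk hp c hc hlow hup => ?_, ⟨?_, ?_⟩, fun c => ⟨?_, ?_⟩⟩
  · exfalso
    have hlow' : theta (p ^ h) k < weight c := by exact_mod_cast hlow
    -- For k = 0, the bound k ≥ n/2 forces n = 0: there is a single point, so no weight exceeds θ_0.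
    rcases Nat.eq_zero_or_pos k with rfl | hk
    · have hn : n = 0 := by
        have h1 : (n : ℚ) ≤ 0 := by
          rw [Nat.cast_zero] at hnk
          linarith
        exact_mod_cast le_antisymm h1 (Nat.cast_nonneg n)
      subst hn
      have := weight_le_one_of_dim_zero c
      omega
    · have hup' : 7 * weight c < 12 * theta (p ^ h) k + 6 := by
        rw [lt_div_iff₀ (by norm_num)] at hup
        have h1 : (7 : ℚ) * weight c < 12 * theta (p ^ h) k + 6 := by linarith
        exact_mod_cast h1
      exact absurd (weight_gap hF hp hk hc hup') (not_le.2 hlow')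
  · obtain ⟨K, hK⟩ := exists_isSpaceOfDim (F := F) hkn
    have h1 := weight_smul_incidenceVector hF (one_ne_zero (α := ZMod p)) hK
    rw [one_smul] at h1
    refine ⟨_, incidenceVector_mem_pgCode hK, ?_, h1⟩
    intro h0
    rw [h0] at h1
    simp [weight] at h1
    omega
  · rintro w ⟨c, hc, hc0, rfl⟩
    exact theta_le_weight hF hc hc0
  · rintro ⟨hc, hw⟩
    exact exists_eq_smul_incidenceVector hF hc hw
  · rintro ⟨a, K, ha, hK, rfl⟩
    exact ⟨Submodule.smul_mem _ _ (incidenceVector_mem_pgCode hK),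
      weight_smul_incidenceVector hF ha hK⟩
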